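/- Let $d\ge 0$, $n\ge 1$. Let $X\in\mathbb R^d$, $M\in\{0,1\}^d$, $Y\in\{-1,1\}$ be random variables on a probability space; $M_j=1$ means that the coordinate $X_j$ is missing. For $m\in\{0,1\}^d$ let $\mathrm{obs}(m)=\{j: m_j=0\}$, let $x_{\mathrm{obs}(m)}$ be the subvector of $x\in\mathbb R^d$ indexed by $\mathrm{obs}(m)$, and put $p_m=\mathbb P(M=m)$. Put $Z=(X_{\mathrm{obs}(M)},M)$. Let the training data $\mathcal D_n=\{(X_{i,\mathrm{obs}(M_i)},M_i,Y_i): 1\le i\le n\}$ be i.i.d. copies of $(X_{\mathrm{obs}(M)},M,Y)$, independent of $(X_{\mathrm{obs}(M)},M,Y)$. Assume the balanced GPMM-LDA model: for every $m$ with $p_m>0$, $\mathbb P(M=m,Y=1)=\mathbb P(M=m,Y=-1)$, and for $k=\pm1$ the conditional law of $X_{\mathrm{obs}(m)}$ given $M=m$ and $Y=k$ is $\mathcal N(\mu_{m,k},\Sigma_m)$, with $\mu_{m,k}\in\mathbb R^{\mathrm{obs}(m)}$ and $\Sigma_m$ symmetric positive definite. Let $\mathrm{sign}(t)=1$ for $t\ge0$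 and $\mathrm{sign}(t)=-1$ for $t<0$. The Bayes classifier is $h^\star(Z)=\mathrm{sign}(\mathbb E[Y\mid Z])$. For $\tau\in\mathbb R$, let $N_{m,k}=\#\{i: M_i=m,\ Y_i=k\}$, let $\widehat\mu_{m,k}=\frac1{N_{m,k}}\sum_{i:\,M_i=m,\,Y_i=k}X_{i,\mathrm{obs}(m)}$ (with $\widehat\mu_{m,k}=0$ if $N_{m,k}=0$), and let $\widetilde\mu_{m,k}=\widehat\mu_{m,k}\mathbf 1_{N_{m,k}/n>\tau}$. The plug-in pattern-by-pattern classifier $\widetilde h$ is given, on the pattern $m$, by $$\widetilde h_m(x)=\mathrm{sign}\Big((\widetilde\mu_{m,1}-\widetilde\mu_{m,-1})^\top\Sigma_m^{-1}\big(x-\tfrac12(\widetilde\mu_{m,1}+\widetilde\mu_{m,-1})\big)\Big),\qquad x\in\mathbb R^{\mathrm{obs}(m)}.$$ Let $\mathcal R_{\mathrm{mis}}(h)=\mathbb P(Y\ne h(Z))$; for $\widetilde h$ the probability is also over the training data. Write $\|\mu_m\|=\max(\|\mu_{m,1}\|,\|\mu_{m,-1}\|)$ (Euclidean norms), $\lambda_{\min}$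 for the smallest eigenvalue, and $a\wedge b=\min(a,b)$. If $\tau\ge\sqrt{d/n}$, then $$\mathcal R_{\mathrm{mis}}(\widetilde h)-\mathcal R_{\mathrm{mis}}(h^\star)\le\sum_{m\in\{0,1\}^d}\left(\frac4{\sqrt{2\pi}}+\frac8{\sqrt\pi}\,\frac{\|\mu_m\|}{\sqrt{\lambda_{\min}(\Sigma_m)}}\right)(\tau\wedge p_m)+\sum_{\substack{m\in\{0,1\}^d\\ p_m\ge\tau}}\frac{\sqrt2\,\|\mu_m\|}{\sqrt{\pi\,\lambda_{\min}(\Sigma_m)}}\,p_m(1-p_m)^{n/2}.$$ Here the quotients by $\sqrt{\lambda_{\min}(\Sigma_m)}$ and $\sqrt{\pi\lambda_{\min}(\Sigma_m)}$ are read as $0$ if $\mathrm{obs}(m)=\emptyset$, and the terms with $p_m=0$ are $0$. -/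

import Mathlib

open MeasureTheory ProbabilityTheory
open scoped Matrix

noncomputable section

namespace MissingLDA

/-- Missing patterns `m ∈ {0,1}^d`: `m j = true` means that coordinate `j` is missing. -/
abbrev Pattern (d : ℕ) : Type := Fin d → Bool

/-- The set `obs(m)` of observed coordinates, as a type. -/
abbrev ObsIdx {d : ℕ} (m : Pattern d) : Type := {j : Fin d // m j = false}

/-- The Euclidean space `ℝ^{obs(m)}`. -/
abbrev ObsSpace {d : ℕ} (m : Pattern d) : Type := EuclideanSpace ℝ (ObsIdx m)

/-- The subvector `x_{obs(m)}` of `x`. -/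
def restrict {d : ℕ} (m : Pattern d) (x : EuclideanSpace ℝ (Fin d)) : ObsSpace m :=
  WithLp.toLp 2 (fun j : ObsIdx m => x j)

/-- The space of the incomplete inputs `z = (x_{obs(m)}, m)`. -/
abbrev ObsInput (d : ℕ) : Type := (m : Pattern d) × ObsSpace m

/-- The incomplete input `(x_{obs(m)}, m)` that is left of the pair `(x, m)`. -/
def observe {d : ℕ} (x : EuclideanSpace ℝ (Fin d)) (m : Pattern d) : ObsInput d :=
  ⟨m, restrict m x⟩

/-- `sign(t) = 1` if `t ≥ 0`, and `-1` if `t < 0`. The labels `{-1, 1}` are the units of `ℤ`. -/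
def sgn (t : ℝ) : ℤˣ := if 0 ≤ t then 1 else -1

/-- Smallest eigenvalue of a symmetric real matrix (`0` for the matrix of size zero). -/
def lambdaMin {ι : Type*} [Fintype ι] [DecidableEq ι] (A : Matrix ι ι ℝ) : ℝ :=
  sInf (spectrum ℝ A)

section Estimators

variable {d n : ℕ}

/-- The number `N_{m,k}` of observations of class `k` with missing pattern `m`. -/
def classCount (M : Fin n → Pattern d) (Y : Fin n → ℤˣ) (m : Pattern d) (k : ℤˣ) : ℕ :=
  (Finset.univ.filter (fun i => M i = m ∧ Y i = k)).card

/-- The mean `μ̂_{m,k}` of the `X_{i,obs(m)}` over the `i` with `M_i = m` and `Y_i = k`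
(zero if there is no such `i`). It only involves observed coordinates. -/
def classMean (X : Fin n → EuclideanSpace ℝ (Fin d)) (M : Fin n → Pattern d) (Y : Fin n → ℤˣ)
    (m : Pattern d) (k : ℤˣ) : ObsSpace m :=
  (classCount M Y m k : ℝ)⁻¹ •
    ∑ i ∈ Finset.univ.filter (fun i => M i = m ∧ Y i = k), restrict m (X i)

open Classical in
/-- The thresholded mean `μ̃_{m,k}`, equal to `μ̂_{m,k}` if `N_{m,k} / n > τ` and to `0` otherwise. -/
def thresholdedMean (τ : ℝ) (X : Fin n → EuclideanSpace ℝ (Fin d)) (M : Fin n → Pattern d)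
    (Y : Fin n → ℤˣ) (m : Pattern d) (k : ℤˣ) : ObsSpace m :=
  if τ < (classCount M Y m k : ℝ) / n then classMean X M Y m k else 0

/-- The linear discriminant rule with means `a` (class `1`) and `b` (class `-1`) and covariance `S`:
`x ↦ sign ((a - b)ᵀ S⁻¹ (x - (a + b) / 2))`. -/
def ldaRule {ι : Type*} [Fintype ι] [DecidableEq ι] (S : Matrix ι ι ℝ)
    (a b x : EuclideanSpace ℝ ι) : ℤˣ :=
  sgn ((a - b).ofLp ⬝ᵥ (S⁻¹ *ᵥ (x - (2⁻¹ : ℝ) • (a + b)).ofLp))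

/-- The plug-in pattern-by-pattern classifier `h̃`, trained on the sample `(X_i, M_i, Y_i)`. -/
def plugInClassifier (Sigma : (m : Pattern d) → Matrix (ObsIdx m) (ObsIdx m) ℝ) (τ : ℝ)
    (X : Fin n → EuclideanSpace ℝ (Fin d)) (M : Fin n → Pattern d) (Y : Fin n → ℤˣ)
    (z : ObsInput d) : ℤˣ :=
  ldaRule (Sigma z.1) (thresholdedMean τ X M Y z.1 1) (thresholdedMean τ X M Y z.1 (-1)) z.2

end Estimators

section Model

variable {Ω : Type*} [MeasurableSpace Ω] {d n : ℕ}

/-- Probability of misclassification of the label `Y` by the prediction `H`. -/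
def misRisk (P : Measure Ω) (Y H : Ω → ℤˣ) : ℝ := P.real {ω | Y ω ≠ H ω}

/-- The prediction `h⋆(Z) = sign(E[Y | Z])` of the Bayes classifier, where `E[Y | Z]` is the
conditional expectation given the σ-algebra generated by `Z = (X_{obs(M)}, M)`. -/
def bayesPrediction (P : Measure Ω) (Z : Ω → ObsInput d) (Y : Ω → ℤˣ) (ω : Ω) : ℤˣ :=
  sgn ((P[(fun ω' => (((Y ω' : ℤˣ) : ℤ) : ℝ)) | MeasurableSpace.comap Z inferInstance]) ω)

/-- The probability `p_m = P(M = m)` of a missing pattern. -/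
def patternProb (P : Measure Ω) (M : Ω → Pattern d) (m : Pattern d) : ℝ := P.real {ω | M ω = m}

/-- The Gaussian pattern mixture model for linear discriminant analysis, with classes balanced on
each missing pattern: on each pattern `m` of positive probability, `X_{obs(m)}` given `M = m` and
`Y = k` has law `N(μ_{m,k}, Σ_m)` with `Σ_m` invertible. Nothing is required of `μ_{m,k}` and `Σ_m`
for the patterns of probability zero. -/
structure IsBalancedGPMMLDA (P : Measure Ω) (X : Ω → EuclideanSpace ℝ (Fin d))
    (M : Ω → Pattern d) (Y : Ω → ℤˣ) (mu : (m : Pattern d) → ℤˣ → ObsSpace m)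
    (Sigma : (m : Pattern d) → Matrix (ObsIdx m) (ObsIdx m) ℝ) : Prop where
  posDef : ∀ m, P {ω | M ω = m} ≠ 0 → (Sigma m).PosDef
  gaussian : ∀ m, P {ω | M ω = m} ≠ 0 → ∀ k : ℤˣ,
    (P[|{ω | M ω = m ∧ Y ω = k}]).map (fun ω => restrict m (X ω)) =
      multivariateGaussian (mu m k) (Sigma m)
  balanced : ∀ m, P {ω | M ω = m ∧ Y ω = 1} = P {ω | M ω = m ∧ Y ω = -1}

/-- The incomplete training data `(X_{i,obs(M_i)}, M_i, Y_i)`, `i < n`, are independent copies of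
`(X_{obs(M)}, M, Y)`, and independent of it. -/
structure IsIIDSample (P : Measure Ω) (X : Ω → EuclideanSpace ℝ (Fin d))
    (M : Ω → Pattern d) (Y : Ω → ℤˣ) (Xs : Fin n → Ω → EuclideanSpace ℝ (Fin d))
    (Ms : Fin n → Ω → Pattern d) (Ys : Fin n → Ω → ℤˣ) : Prop where
  identDistrib : ∀ i, IdentDistrib (fun ω => (observe (Xs i ω) (Ms i ω), Ys i ω))
    (fun ω => (observe (X ω) (M ω), Y ω)) P P
  iIndepFun : iIndepFun (fun i ω => (observe (Xs i ω) (Ms i ω), Ys i ω)) P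
  indepFun : IndepFun (fun ω i => (observe (Xs i ω) (Ms i ω), Ys i ω))
    (fun ω => (observe (X ω) (M ω), Y ω)) P

end Model

end MissingLDA

end

open MissingLDA

/-!
The classifier is a plug-in rule, so its excess risk is controlled by the error of the plugged-in
means. Everything happens separately on each pattern `m` with `p = p_m > 0`, after whitening by
`Σ_m^{-1/2}` (`whiten`).

*From means to risk.* The linear discriminant rule built from `a` and `b` is the Neyman-Pearson
optimal test between `N(a, Σ)` and `N(b, Σ)` (`ldaRule_error_le`; the densities come from the
Cameron-Martin formula `map_const_add_stdGaussian`). It therefore beats every other rule as long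
as the data come from these two laws. The true class laws are `N(μ₁, Σ)` and `N(μ₋₁, Σ)`, and
replacing one pair of laws by the other, before and after the comparison, costs twice the sum of
the two total variation distances. The distance between `N(u, Σ)` and `N(v, Σ)` is at most
`‖Σ^{-1/2} (u - v)‖ / √(2π)` (`multivariateGaussian_real_le`): the worst event is the discriminant
halfspace, and it reduces to an interval for a one-dimensional Gaussian. This gives
`ldaRule_excess_le`, a comparison with an arbitrary measurable rule, in particular with the Bayes
classifier, which depends on the observed input only. As the sample is independent of the new
point, the sample can be frozen (`indepFun_real_mem_eq_integral`), and the excess risk on the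
pattern is at most `p / √(2π)` times the sum over the two classes of the mean whitened errors
`E ‖Σ^{-1/2} (μ̃ - μ)‖` of the thresholded means.

*Errors of the thresholded means.* Let `N` be the number of observations in the cell `(m, k)`, a
binomial variable with parameters `n` and `p / 2`. The whitened residuals of the cell are centred,
and on the event that the `i`-th observation is in the cell, `N` is one plus a count that is
independent of it. Hence the cross terms in the second moment of the sum of the residuals vanish,
even when weighted by a function of `N` (`integral_hitCount_mul_norm_sum_sq`), and the mean
squared error on `{N > nτ}` is at most `E [|obs(m)| / N; N > nτ]`. The same leave-one-out
identity yields `E [1 / (N + 1)] ≤ 2 / (n p)` (`integral_inv_hitCount_add_one_le`). This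
inverse moment bounds the error on `{N > nτ}` by `√(4 d / (n p)) ≤ 2 τ / p`, and by Markov's inequality it also bounds
`P(N ≤ nτ)`, which multiplies the bias `‖Σ^{-1/2} μ‖ ≤ ‖μ‖ / √λ_min(Σ)`, by
`2 (nτ + 1) / (n p) ≤ 4 τ / p` (if some coordinate is observed, then `d ≥ 1` and `nτ ≥ 1`;
otherwise there is no bias). This settles the patterns with `p ≥ τ`; if `p < τ`, the error is at
most `1` plus the bias (`mul_error_le_min`). The second sum in the bound is nonnegative, and the
first one alone is large enough.
-/

namespace MissingLDA

open scoped RealInnerProductSpace ENNReal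
open WithLp

/-! ### Translates of the standard Gaussian law -/

section GaussianShift

variable {ι : Type*} [Fintype ι]

/-- Density, with respect to the standard Gaussian law, of its translate by `u`. -/
noncomputable def shiftDensity (u x : EuclideanSpace ℝ ι) : ℝ :=
  Real.exp (⟪u, x⟫ - ‖u‖ ^ 2 / 2)

@[fun_prop]
lemma measurable_shiftDensity (u : EuclideanSpace ℝ ι) : Measurable (shiftDensity u) := by
  unfold shiftDensity
  fun_prop

lemma shiftDensity_pos (u x : EuclideanSpace ℝ ι) : 0 < shiftDensity u x := Real.exp_pos _

lemma shiftDensity_eq_prod (u x : EuclideanSpace ℝ ι) :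
    shiftDensity u x = ∏ i, Real.exp (u i * x i - u i ^ 2 / 2) := by
  rw [shiftDensity, ← Real.exp_sum, EuclideanSpace.real_norm_sq_eq, PiLp.inner_apply,
    Finset.sum_sub_distrib, Finset.sum_div]
  simp [mul_comm]

lemma integrable_shiftDensity (u : EuclideanSpace ℝ ι) :
    Integrable (shiftDensity u) (stdGaussian (EuclideanSpace ℝ ι)) := by
  rw [← map_pi_eq_stdGaussian, integrable_map_measure (by fun_prop) (by fun_prop)]
  have h : shiftDensity u ∘ toLp 2 = fun x : ι → ℝ => ∏ i, Real.exp (u i * x i - u i ^ 2 / 2) := by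
    ext x
    simp [shiftDensity_eq_prod]
  rw [h]
  refine Integrable.fintype_prod (f := fun i x => Real.exp (u i * x - u i ^ 2 / 2)) fun i => ?_
  simp_rw [Real.exp_sub]
  exact (integrable_exp_mul_gaussianReal (u i)).div_const _

instance (u : EuclideanSpace ℝ ι) : IsFiniteMeasure
    ((stdGaussian (EuclideanSpace ℝ ι)).withDensity fun x => ENNReal.ofReal (shiftDensity u x)) :=
  isFiniteMeasure_withDensity_ofReal (integrable_shiftDensity u).2

/-- The one-dimensional computation behind the Cameron-Martin formula. -/
lemma integral_exp_mul_cexp_gaussianReal (a t : ℝ) :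
    ∫ x, (Real.exp (a * x - a ^ 2 / 2) : ℂ) * Complex.exp (x * t * Complex.I) ∂gaussianReal 0 1 =
      Complex.exp (a * t * Complex.I - t ^ 2 / 2) := by
  have h := complexMGF_id_gaussianReal (μ := 0) (v := 1) (a + t * Complex.I)
  rw [complexMGF] at h
  have e (x : ℝ) : (Real.exp (a * x - a ^ 2 / 2) : ℂ) * Complex.exp (x * t * Complex.I) =
      Complex.exp (-a ^ 2 / 2) * Complex.exp ((a + t * Complex.I) * x) := by
    rw [Complex.ofReal_exp, ← Complex.exp_add, ← Complex.exp_add]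
    push_cast
    ring_nf
  simp_rw [e]
  rw [integral_const_mul]
  simp only [id] at h
  rw [h, ← Complex.exp_add]
  congr 1
  push_cast
  ring_nf
  simp
  ring

/-- Cameron-Martin formula for the standard Gaussian law. -/
lemma map_const_add_stdGaussian (u : EuclideanSpace ℝ ι) :
    (stdGaussian (EuclideanSpace ℝ ι)).map (fun x => u + x) =
      (stdGaussian (EuclideanSpace ℝ ι)).withDensity fun x =>
        ENNReal.ofReal (shiftDensity u x) := by
  have : IsProbabilityMeasure ((stdGaussian (EuclideanSpace ℝ ι)).map (fun x => u + x)) :=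
    Measure.isProbabilityMeasure_map (by fun_prop)
  apply Measure.ext_of_charFun
  ext t
  rw [charFun_map_const_add, charFun_stdGaussian, charFun_apply,
    integral_withDensity_eq_integral_toReal_smul (by fun_prop) (by simp)]
  simp_rw [ENNReal.toReal_ofReal (shiftDensity_pos u _).le, Complex.real_smul]
  rw [← map_pi_eq_stdGaussian, integral_map (by fun_prop)
    (Measurable.aestronglyMeasurable (by fun_prop))]
  have h (x : ι → ℝ) : (shiftDensity u (toLp 2 x) : ℂ) *
      Complex.exp (⟪toLp 2 x, t⟫ * Complex.I) =
      ∏ i, (Real.exp (u i * x i - u i ^ 2 / 2) : ℂ) * Complex.exp (x i * t i * Complex.I) := by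
    rw [shiftDensity_eq_prod, Finset.prod_mul_distrib, ← Complex.exp_sum, PiLp.inner_apply]
    push_cast
    rw [Finset.sum_mul]
    simp [mul_comm]
  simp_rw [h]
  rw [integral_fintype_prod_eq_prod (f := fun i (x : ℝ) =>
    (Real.exp (u i * x - u i ^ 2 / 2) : ℂ) * Complex.exp (x * t i * Complex.I))]
  simp_rw [integral_exp_mul_cexp_gaussianReal]
  rw [← Complex.exp_sum, ← Complex.exp_add, Finset.sum_sub_distrib, ← Finset.sum_mul]
  congr 1
  rw [PiLp.inner_apply, ← Complex.ofReal_pow, EuclideanSpace.real_norm_sq_eq]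
  push_cast
  rw [← Finset.sum_div]
  simp only [RCLike.inner_apply, conj_trivial, mul_comm (t _)]
  push_cast
  ring

/-- Neyman-Pearson: the sum of the two error probabilities is smallest for the test that compares
the densities. -/
lemma neymanPearson {α : Type*} [MeasurableSpace α] (γ : Measure α) {f g : α → ℝ≥0∞}
    (hf : Measurable f) (hg : Measurable g) {T : Set α} (hT : MeasurableSet T) :
    γ.withDensity f {x | g x ≤ f x}ᶜ + γ.withDensity g {x | g x ≤ f x} ≤
      γ.withDensity f Tᶜ + γ.withDensity g T := by
  have hH : MeasurableSet {x | g x ≤ f x} := measurableSet_le hg hf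
  have key : γ.withDensity f {x | g x ≤ f x}ᶜ + γ.withDensity g {x | g x ≤ f x} =
      ∫⁻ x, min (f x) (g x) ∂γ := by
    rw [withDensity_apply _ hH.compl, withDensity_apply _ hH,
      ← lintegral_add_compl (fun x => min (f x) (g x)) hH, add_comm]
    congr 1
    · exact setLIntegral_congr_fun hH fun x hx => (min_eq_right hx).symm
    · exact setLIntegral_congr_fun hH.compl fun x hx =>
        (min_eq_left (not_le.1 (by exact hx)).le).symm
  rw [key, withDensity_apply _ hT.compl, withDensity_apply _ hT,
    ← lintegral_add_compl (fun x => min (f x) (g x)) hT, add_comm]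
  gcongr
  · exact min_le_left _ _
  · exact min_le_right _ _

lemma shiftDensity_le_iff (u v x : EuclideanSpace ℝ ι) :
    ENNReal.ofReal (shiftDensity v x) ≤ ENNReal.ofReal (shiftDensity u x) ↔
      0 ≤ ⟪u - v, x - (2⁻¹ : ℝ) • (u + v)⟫ := by
  rw [ENNReal.ofReal_le_ofReal_iff (shiftDensity_pos u x).le, shiftDensity, shiftDensity,
    Real.exp_le_exp]
  have : ⟪u - v, x - (2⁻¹ : ℝ) • (u + v)⟫ =
      (⟪u, x⟫ - ‖u‖ ^ 2 / 2) - (⟪v, x⟫ - ‖v‖ ^ 2 / 2) := by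
    simp only [inner_sub_left, inner_sub_right, inner_smul_right, inner_add_right,
      real_inner_self_eq_norm_sq, real_inner_comm u v]
    ring
  rw [this, sub_nonneg]

/-- The halfspace of the points closer to `u` than to `v` is the optimal test between the translates
by `u` and by `v` of the standard Gaussian law. -/
lemma halfspace_error_le (u v : EuclideanSpace ℝ ι) {T : Set (EuclideanSpace ℝ ι)}
    (hT : MeasurableSet T) :
    ((stdGaussian _).map (fun x => u + x)).real {x | 0 ≤ ⟪u - v, x - (2⁻¹ : ℝ) • (u + v)⟫}ᶜ +
      ((stdGaussian _).map (fun x => v + x)).real {x | 0 ≤ ⟪u - v, x - (2⁻¹ : ℝ) • (u + v)⟫} ≤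
    ((stdGaussian _).map (fun x => u + x)).real Tᶜ +
      ((stdGaussian _).map (fun x => v + x)).real T := by
  rw [map_const_add_stdGaussian, map_const_add_stdGaussian]
  simp_rw [← shiftDensity_le_iff, measureReal_def]
  rw [← ENNReal.toReal_add (by finiteness) (by finiteness),
    ← ENNReal.toReal_add (by finiteness) (by finiteness)]
  refine ENNReal.toReal_mono (by finiteness) (neymanPearson _ (by fun_prop) (by fun_prop) hT)

lemma gaussianReal_real_le (v : NNReal) (hv : v ≠ 0) (a b : ℝ) (hab : a ≤ b) :
    (gaussianReal 0 v).real (Set.Ico a b) ≤ (b - a) / √(2 * Real.pi * v) := by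
  rw [measureReal_def, gaussianReal_apply_eq_integral 0 hv, ENNReal.toReal_ofReal
    (integral_nonneg fun x => gaussianPDFReal_nonneg 0 v x)]
  calc ∫ x in Set.Ico a b, gaussianPDFReal 0 v x
      ≤ ∫ x in Set.Ico a b, (√(2 * Real.pi * v))⁻¹ := by
        refine setIntegral_mono (integrable_gaussianPDFReal 0 v).integrableOn
          (integrableOn_const (by simp)) fun x => ?_
        rw [gaussianPDFReal]
        refine mul_le_of_le_one_right (by positivity) (Real.exp_le_one_iff.2 ?_)
        exact div_nonpos_of_nonpos_of_nonneg (by nlinarith [sq_nonneg (x - 0)]) (by positivity)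
    _ = (b - a) / √(2 * Real.pi * v) := by simp [hab, div_eq_mul_inv]

lemma map_inner_stdGaussian (u : EuclideanSpace ℝ ι) :
    (stdGaussian (EuclideanSpace ℝ ι)).map (fun x => ⟪u, x⟫) =
      gaussianReal 0 (‖u‖ ^ 2).toNNReal := by
  have h := IsGaussian.map_eq_gaussianReal (μ := stdGaussian (EuclideanSpace ℝ ι)) (innerSL ℝ u)
  rw [integral_strongDual_stdGaussian, variance_dual_stdGaussian, innerSL_apply_norm] at h
  exact h

/-- Two translates of the standard Gaussian law are close in total variation. The halfspace of
`halfspace_error_le` is the worst set, and for it this is a one-dimensional estimate. -/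
lemma shift_real_le (u v : EuclideanSpace ℝ ι) {T : Set (EuclideanSpace ℝ ι)}
    (hT : MeasurableSet T) :
    ((stdGaussian _).map (fun x => u + x)).real T ≤
      ((stdGaussian _).map (fun x => v + x)).real T + ‖u - v‖ / √(2 * Real.pi) := by
  have (w : EuclideanSpace ℝ ι) : IsProbabilityMeasure ((stdGaussian _).map (fun x => w + x)) :=
    Measure.isProbabilityMeasure_map (by fun_prop)
  rcases eq_or_ne u v with rfl | huv
  · simp
  set γ := stdGaussian (EuclideanSpace ℝ ι)
  set H : Set (EuclideanSpace ℝ ι) := {x | 0 ≤ ⟪u - v, x - (2⁻¹ : ℝ) • (u + v)⟫} with hHdef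
  have hH : MeasurableSet H := measurableSet_le measurable_const (by fun_prop)
  have h := halfspace_error_le u v hT
  rw [← hHdef] at h
  rw [probReal_compl_eq_one_sub hT, probReal_compl_eq_one_sub hH] at h
  have hpos : 0 < ‖u - v‖ := norm_pos_iff.2 (sub_ne_zero.2 huv)
  have hu : (γ.map (fun x => u + x)).real H = γ.real {x | -(‖u - v‖ ^ 2 / 2) ≤ ⟪u - v, x⟫} := by
    rw [map_measureReal_apply (by fun_prop) hH]
    congr 1 with x
    have : u + x - (2⁻¹ : ℝ) • (u + v) = x + (2⁻¹ : ℝ) • (u - v) := by module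
    simp only [hHdef, Set.mem_preimage, Set.mem_ofPred_eq]
    rw [this, inner_add_right, inner_smul_right, real_inner_self_eq_norm_sq]
    constructor <;> intro h <;> linarith
  have hv : (γ.map (fun x => v + x)).real H = γ.real {x | ‖u - v‖ ^ 2 / 2 ≤ ⟪u - v, x⟫} := by
    rw [map_measureReal_apply (by fun_prop) hH]
    congr 1 with x
    have : v + x - (2⁻¹ : ℝ) • (u + v) = x - (2⁻¹ : ℝ) • (u - v) := by module
    simp only [hHdef, Set.mem_preimage, Set.mem_ofPred_eq]
    rw [this, inner_sub_right, inner_smul_right, real_inner_self_eq_norm_sq]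
    constructor <;> intro h <;> linarith
  have hI : γ.real {x | -(‖u - v‖ ^ 2 / 2) ≤ ⟪u - v, x⟫} ≤
      γ.real {x | ‖u - v‖ ^ 2 / 2 ≤ ⟪u - v, x⟫} + (gaussianReal 0 (‖u - v‖ ^ 2).toNNReal).real
        (Set.Ico (-(‖u - v‖ ^ 2 / 2)) (‖u - v‖ ^ 2 / 2)) := by
    rw [← map_inner_stdGaussian, map_measureReal_apply (by fun_prop) measurableSet_Ico]
    refine (measureReal_mono ?_).trans (measureReal_union_le _ _)
    intro x hx
    by_cases h' : ‖u - v‖ ^ 2 / 2 ≤ ⟪u - v, x⟫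
    · exact Or.inl h'
    · exact Or.inr ⟨hx, not_le.1 h'⟩
  have hb := gaussianReal_real_le (‖u - v‖ ^ 2).toNNReal
    (by simpa using hpos) (-(‖u - v‖ ^ 2 / 2)) (‖u - v‖ ^ 2 / 2) (by nlinarith)
  have e : (‖u - v‖ ^ 2 / 2 - -(‖u - v‖ ^ 2 / 2)) / √(2 * Real.pi * (‖u - v‖ ^ 2).toNNReal) =
      ‖u - v‖ / √(2 * Real.pi) := by
    rw [Real.coe_toNNReal _ (by positivity), Real.sqrt_mul (by positivity), Real.sqrt_sq hpos.le]
    field_simp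
    ring
  rw [e] at hb
  linarith

lemma integral_norm_sq_stdGaussian :
    ∫ x, ‖x‖ ^ 2 ∂stdGaussian (EuclideanSpace ℝ ι) = Fintype.card ι := by
  rw [← map_pi_eq_stdGaussian, integral_map (by fun_prop)
    (Measurable.aestronglyMeasurable (by fun_prop))]
  simp_rw [EuclideanSpace.real_norm_sq_eq]
  have hint : Integrable (fun x : ℝ => x ^ 2) (gaussianReal 0 1) :=
    (IsGaussian.memLp_two_id (μ := gaussianReal 0 1)).integrable_sq
  have h1 : ∫ x, x ^ 2 ∂gaussianReal 0 1 = 1 := by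
    have h := variance_fun_id_gaussianReal (μ := 0) (v := 1)
    rw [variance_of_integral_eq_zero (by fun_prop) (by simp)] at h
    simpa using h
  rw [integral_finsetSum]
  · simp_rw [integral_comp_eval (μ := fun _ : ι => gaussianReal 0 1) (f := fun x : ℝ => x ^ 2)
      hint.aestronglyMeasurable, h1]
    simp
  · intro i _
    exact integrable_comp_eval (μ := fun _ : ι => gaussianReal 0 1) (f := fun x : ℝ => x ^ 2) hint

end GaussianShift

/-! ### Whitening and the linear discriminant rule -/

section Whitening

open scoped MatrixOrder
open Matrix

variable {ι : Type*} [Fintype ι] [DecidableEq ι] {S : Matrix ι ι ℝ}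

/-- The whitening map `S^{-1/2}`, for a positive definite matrix `S`. -/
noncomputable def whiten (S : Matrix ι ι ℝ) : EuclideanSpace ℝ ι →L[ℝ] EuclideanSpace ℝ ι :=
  toEuclideanCLM (𝕜 := ℝ) (CFC.sqrt S)⁻¹

/-- The square root `S^{1/2}` as a linear map. -/
noncomputable def colour (S : Matrix ι ι ℝ) : EuclideanSpace ℝ ι →L[ℝ] EuclideanSpace ℝ ι :=
  toEuclideanCLM (𝕜 := ℝ) (CFC.sqrt S)

lemma isUnit_det_sqrt (hS : S.PosDef) : IsUnit (CFC.sqrt S).det := by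
  rw [← Matrix.isUnit_iff_isUnit_det, CFC.isUnit_sqrt_iff S hS.posSemidef.nonneg]
  exact hS.isUnit

lemma colour_whiten (hS : S.PosDef) (x : EuclideanSpace ℝ ι) : colour S (whiten S x) = x := by
  have h : colour S * whiten S = 1 := by
    rw [colour, whiten, ← map_mul, mul_nonsing_inv _ (isUnit_det_sqrt hS), map_one]
  simpa using DFunLike.congr_fun h x

lemma whiten_colour (hS : S.PosDef) (x : EuclideanSpace ℝ ι) : whiten S (colour S x) = x := by
  have h : whiten S * colour S = 1 := by
    rw [colour, whiten, ← map_mul, nonsing_inv_mul _ (isUnit_det_sqrt hS), map_one]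
  simpa using DFunLike.congr_fun h x

lemma dotProduct_inv_mulVec (hS : S.PosDef) (x y : EuclideanSpace ℝ ι) :
    x.ofLp ⬝ᵥ (S⁻¹ *ᵥ y.ofLp) = ⟪whiten S x, whiten S y⟫ := by
  have hsa : IsSelfAdjoint (whiten S) := by
    have h : IsSelfAdjoint (CFC.sqrt S)⁻¹ :=
      (CFC.sqrt_nonneg S).posSemidef.inv.isHermitian
    exact h.map _
  rw [← ContinuousLinearMap.adjoint_inner_right, hsa.adjoint_eq,
    ← ContinuousLinearMap.comp_apply, ← ContinuousLinearMap.mul_def, whiten, ← map_mul,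
    ← Matrix.mul_inv_rev, CFC.sqrt_mul_sqrt_self S hS.posSemidef.nonneg, inner_toEuclideanCLM]

lemma norm_colour_sq (hS : S.PosDef) (x : EuclideanSpace ℝ ι) :
    ‖colour S x‖ ^ 2 = x.ofLp ⬝ᵥ (S *ᵥ x.ofLp) := by
  have hsa : IsSelfAdjoint (colour S) := (CFC.sqrt_nonneg S).isSelfAdjoint.map _
  rw [← real_inner_self_eq_norm_sq, ← ContinuousLinearMap.adjoint_inner_right, hsa.adjoint_eq,
    ← ContinuousLinearMap.comp_apply, ← ContinuousLinearMap.mul_def, colour, ← map_mul,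
    CFC.sqrt_mul_sqrt_self S hS.posSemidef.nonneg, inner_toEuclideanCLM]

lemma lambdaMin_pos [Nonempty ι] (hS : S.PosDef) : 0 < lambdaMin S := by
  have hmem : sInf (spectrum ℝ S) ∈ spectrum ℝ S := by
    rw [hS.isHermitian.spectrum_real_eq_range_eigenvalues]
    exact (Set.range_nonempty _).csInf_mem (Set.finite_range _)
  obtain ⟨i, hi⟩ := hS.isHermitian.spectrum_real_eq_range_eigenvalues ▸ hmem
  rw [lambdaMin, hS.isHermitian.spectrum_real_eq_range_eigenvalues, ← hi]
  exact hS.eigenvalues_pos i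

lemma lambdaMin_mul_le (hS : S.PosDef) (x : EuclideanSpace ℝ ι) :
    lambdaMin S * ‖x‖ ^ 2 ≤ ‖colour S x‖ ^ 2 := by
  have hle : algebraMap ℝ (Matrix ι ι ℝ) (lambdaMin S) ≤ S := by
    rw [algebraMap_le_iff_le_spectrum (a := S) hS.isHermitian]
    intro y hy
    refine csInf_le ?_ hy
    rw [hS.isHermitian.spectrum_real_eq_range_eigenvalues]
    exact (Set.finite_range _).bddBelow
  have h := (Matrix.le_iff.1 hle).dotProduct_mulVec_nonneg x.ofLp
  rw [norm_colour_sq hS, EuclideanSpace.real_norm_sq_eq]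
  rw [Matrix.sub_mulVec, dotProduct_sub, Algebra.algebraMap_eq_smul_one, Matrix.smul_mulVec,
    Matrix.one_mulVec, dotProduct_smul] at h
  simp only [star_trivial, smul_eq_mul] at h
  have e : x.ofLp ⬝ᵥ x.ofLp = ∑ i, x i ^ 2 := by simp [dotProduct, sq]
  rw [e] at h
  linarith

lemma norm_whiten_le (hS : S.PosDef) (x : EuclideanSpace ℝ ι) :
    ‖whiten S x‖ ≤ ‖x‖ / √(lambdaMin S) := by
  rcases isEmpty_or_nonempty ι with hι | hι
  · have : whiten S x = 0 := Subsingleton.elim _ _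
    rw [this, norm_zero]
    positivity
  · have hpos := lambdaMin_pos hS
    have h := lambdaMin_mul_le hS (whiten S x)
    rw [colour_whiten hS] at h
    rw [le_div_iff₀ (Real.sqrt_pos.2 hpos)]
    refine abs_le_of_sq_le_sq' ?_ (norm_nonneg x) |>.2
    rw [mul_pow, Real.sq_sqrt hpos.le]
    linarith

lemma multivariateGaussian_eq_map (hS : S.PosDef) (u : EuclideanSpace ℝ ι) :
    multivariateGaussian u S =
      ((stdGaussian (EuclideanSpace ℝ ι)).map (fun x => whiten S u + x)).map (colour S) := by
  rw [multivariateGaussian, Measure.map_map (by fun_prop) (by fun_prop)]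
  congr 1 with x : 1
  simp only [Function.comp_apply, map_add, colour_whiten hS]
  rfl

lemma multivariateGaussian_real_apply (hS : S.PosDef) (u : EuclideanSpace ℝ ι)
    {T : Set (EuclideanSpace ℝ ι)} (hT : MeasurableSet T) :
    (multivariateGaussian u S).real T =
      ((stdGaussian (EuclideanSpace ℝ ι)).map (fun x => whiten S u + x)).real
        (colour S ⁻¹' T) := by
  rw [multivariateGaussian_eq_map hS, map_measureReal_apply (by fun_prop) hT]

/-- Total variation bound between two Gaussian laws with the same covariance. -/
lemma multivariateGaussian_real_le (hS : S.PosDef) (u v : EuclideanSpace ℝ ι)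
    {T : Set (EuclideanSpace ℝ ι)} (hT : MeasurableSet T) :
    (multivariateGaussian u S).real T ≤
      (multivariateGaussian v S).real T + ‖whiten S (u - v)‖ / √(2 * Real.pi) := by
  rw [multivariateGaussian_real_apply hS u hT, multivariateGaussian_real_apply hS v hT, map_sub]
  exact shift_real_le _ _ ((colour S).measurable hT)

lemma ldaRule_eq_one_iff (S : Matrix ι ι ℝ) (a b x : EuclideanSpace ℝ ι) :
    ldaRule S a b x = 1 ↔ 0 ≤ (a - b).ofLp ⬝ᵥ (S⁻¹ *ᵥ (x - (2⁻¹ : ℝ) • (a + b)).ofLp) := by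
  rw [ldaRule, sgn]
  split_ifs with h
  · exact iff_of_true rfl h
  · exact iff_of_false (by decide) h

lemma measurableSet_ldaRule_eq_one (S : Matrix ι ι ℝ) :
    MeasurableSet {q : (EuclideanSpace ℝ ι × EuclideanSpace ℝ ι) × EuclideanSpace ℝ ι |
      ldaRule S q.1.1 q.1.2 q.2 = 1} := by
  simp_rw [ldaRule_eq_one_iff]
  refine measurableSet_le measurable_const (Continuous.measurable ?_)
  fun_prop

/-- The linear discriminant rule is the optimal test between the Gaussian laws it is built from. -/
lemma ldaRule_error_le (hS : S.PosDef) (a b : EuclideanSpace ℝ ι) {T : Set (EuclideanSpace ℝ ι)}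
    (hT : MeasurableSet T) :
    (multivariateGaussian a S).real {x | ldaRule S a b x = 1}ᶜ +
      (multivariateGaussian b S).real {x | ldaRule S a b x = 1} ≤
    (multivariateGaussian a S).real Tᶜ + (multivariateGaussian b S).real T := by
  have hH : MeasurableSet {x | ldaRule S a b x = 1} :=
    (measurableSet_ldaRule_eq_one S).preimage (f := fun x => ((a, b), x)) (by fun_prop)
  rw [multivariateGaussian_real_apply hS a hH.compl, multivariateGaussian_real_apply hS b hH,
    multivariateGaussian_real_apply hS a hT.compl, multivariateGaussian_real_apply hS b hT]
  have e : colour S ⁻¹' {x | ldaRule S a b x = 1} =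
      {y | 0 ≤ ⟪whiten S a - whiten S b, y - (2⁻¹ : ℝ) • (whiten S a + whiten S b)⟫} := by
    ext y
    simp only [Set.mem_preimage, Set.mem_ofPred_eq, ldaRule_eq_one_iff]
    rw [dotProduct_inv_mulVec hS]
    simp only [map_sub, map_smul, map_add, whiten_colour hS]
  rw [Set.preimage_compl, Set.preimage_compl, e]
  exact halfspace_error_le _ _ ((colour S).measurable hT)

/-- The linear discriminant rule with means `a`, `b` is optimal for `N(a, S)` and `N(b, S)`; passing
to the true laws `N(u, S)` and `N(v, S)` and back costs two total variation distances for each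
class. -/
lemma ldaRule_excess_le (hS : S.PosDef) (a b u v : EuclideanSpace ℝ ι)
    {T : Set (EuclideanSpace ℝ ι)} (hT : MeasurableSet T) :
    (multivariateGaussian u S).real {x | ldaRule S a b x = 1}ᶜ +
      (multivariateGaussian v S).real {x | ldaRule S a b x = 1} ≤
    (multivariateGaussian u S).real Tᶜ + (multivariateGaussian v S).real T +
      2 / √(2 * Real.pi) * (‖whiten S (a - u)‖ + ‖whiten S (b - v)‖) := by
  have hH : MeasurableSet {x | ldaRule S a b x = 1} :=
    (measurableSet_ldaRule_eq_one S).preimage (f := fun x => ((a, b), x)) (by fun_prop)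
  have h1 := multivariateGaussian_real_le hS u a hH.compl
  have h2 := multivariateGaussian_real_le hS v b hH
  have h3 := ldaRule_error_le hS a b hT
  have h4 := multivariateGaussian_real_le hS a u hT.compl
  have h5 := multivariateGaussian_real_le hS b v hT
  rw [← norm_neg, ← map_neg, neg_sub] at h1 h2
  have e : 2 / √(2 * Real.pi) * (‖whiten S (a - u)‖ + ‖whiten S (b - v)‖) =
      2 * (‖whiten S (a - u)‖ / √(2 * Real.pi)) + 2 * (‖whiten S (b - v)‖ / √(2 * Real.pi)) := by
    ring
  linarith

lemma map_whiten_multivariateGaussian (hS : S.PosDef) (u : EuclideanSpace ℝ ι) :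
    (multivariateGaussian u S).map (fun x => whiten S (x - u)) =
      stdGaussian (EuclideanSpace ℝ ι) := by
  rw [multivariateGaussian, Measure.map_map (by fun_prop) (by fun_prop)]
  have : (fun x => whiten S (x - u)) ∘
      (fun x => u + toEuclideanCLM (𝕜 := ℝ) (CFC.sqrt S) x) = id := by
    ext1 x
    simp only [Function.comp_apply, add_sub_cancel_left]
    exact whiten_colour hS x
  rw [this, Measure.map_id]

end Whitening

/-! ### Thresholded averages over a random cell -/

section SelfNormalised

open Classical in
/-- The number of the indices `i` with `t i ∈ A`. -/
noncomputable def hitCount {n : ℕ} {β : Type*} (A : Set β) (t : Fin n → β) : ℕ :=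
  (Finset.univ.filter fun i => t i ∈ A).card

open Classical in
/-- The number of the indices `j ≠ i` with `t j ∈ A`. -/
noncomputable def hitCountErase {n : ℕ} {β : Type*} (A : Set β) (i : Fin n) (t : Fin n → β) : ℕ :=
  ((Finset.univ.erase i).filter fun j => t j ∈ A).card

section Counting

variable {n : ℕ} {β : Type*} {A : Set β}

lemma hitCount_of_mem {t : Fin n → β} {i : Fin n} (h : t i ∈ A) :
    hitCount A t = hitCountErase A i t + 1 := by
  classical
  rw [hitCount, hitCountErase, Finset.filter_erase, Finset.card_erase_add_one]
  simpa using h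

lemma hitCount_le (A : Set β) (t : Fin n → β) : hitCount A t ≤ n := by
  classical
  exact (Finset.card_le_univ _).trans (by simp)

lemma hitCountErase_le (A : Set β) (i : Fin n) (t : Fin n → β) :
    hitCountErase A i t ≤ hitCount A t := by
  classical
  rw [hitCount, hitCountErase]
  exact Finset.card_le_card (Finset.filter_subset_filter _ (Finset.erase_subset _ _))

lemma hitCountErase_update (A : Set β) (i : Fin n) (t : Fin n → β) (b : β) :
    hitCountErase A i (Function.update t i b) = hitCountErase A i t := by
  classical
  rw [hitCountErase, hitCountErase]
  congr 1
  refine Finset.filter_congr fun j hj => ?_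
  rw [Function.update_of_ne (Finset.ne_of_mem_erase hj)]

lemma sum_indicator_eq_hitCount (A : Set β) (t : Fin n → β) :
    ∑ i, A.indicator (fun _ => (1 : ℝ)) (t i) = hitCount A t := by
  classical
  simp [hitCount, Set.indicator_apply]

variable [MeasurableSpace β]

lemma measurable_hitCount (hA : MeasurableSet A) :
    Measurable (hitCount A : (Fin n → β) → ℕ) := by
  classical
  have : (hitCount A : (Fin n → β) → ℕ) = fun t => ∑ i, if t i ∈ A then 1 else 0 := by
    ext t
    simp [hitCount]
  rw [this]
  exact Finset.measurable_sum _ fun i _ => Measurable.ite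
    ((measurable_pi_apply i) hA) measurable_const measurable_const

lemma measurable_hitCountErase (hA : MeasurableSet A) (i : Fin n) :
    Measurable (hitCountErase A i : (Fin n → β) → ℕ) := by
  classical
  have : (hitCountErase A i : (Fin n → β) → ℕ) =
      fun t => ∑ j ∈ Finset.univ.erase i, if t j ∈ A then 1 else 0 := by
    ext t
    simp [hitCountErase]
  rw [this]
  exact Finset.measurable_sum _ fun i _ => Measurable.ite
    ((measurable_pi_apply i) hA) measurable_const measurable_const

end Counting

section Integrals

variable {Ω : Type*} [MeasurableSpace Ω] {P : Measure Ω}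

lemma integrable_inner_of_memLp {E : Type*} [NormedAddCommGroup E] [InnerProductSpace ℝ E]
    {f g : Ω → E} (hf : MemLp f 2 P) (hg : MemLp g 2 P) :
    Integrable (fun ω => ⟪f ω, g ω⟫) P :=
  (hf.norm.integrable_mul hg.norm).mono' (hf.1.inner hg.1)
    (ae_of_all _ fun ω => norm_inner_le_norm (f ω) (g ω))

lemma integral_indicator_one_comp {β : Type*} [MeasurableSpace β] {A : Set β} {f : Ω → β}
    (hf : Measurable f) (hA : MeasurableSet A) :
    ∫ ω, A.indicator (fun _ => (1 : ℝ)) (f ω) ∂P = P.real (f ⁻¹' A) :=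
  integral_indicator_one (hf hA)

end Integrals

variable {Ω : Type*} [MeasurableSpace Ω] {P : Measure Ω} [IsProbabilityMeasure P]
  {n : ℕ} {β : Type*} [MeasurableSpace β] {s : Fin n → Ω → β} {A : Set β}

/-- A statistic that does not depend on the `i`-th observation is independent of it. -/
lemma indepFun_of_update (hs : ∀ i, Measurable (s i)) (hind : iIndepFun s P) (i : Fin n)
    {γ : Type*} [MeasurableSpace γ] {F : (Fin n → β) → γ} (hF : Measurable F)
    (hinv : ∀ t b, F (Function.update t i b) = F t) :
    IndepFun (fun ω => F (fun j => s j ω)) (s i) P := by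
  classical
  obtain ⟨ω₀⟩ : Nonempty Ω := nonempty_of_isProbabilityMeasure P
  let fill : ((j : (Finset.univ.erase i : Finset (Fin n))) → β) → Fin n → β :=
    fun r j => if h : j ∈ Finset.univ.erase i then r ⟨j, h⟩ else s i ω₀
  have hfill : Measurable fill := by
    refine measurable_pi_iff.2 fun j => ?_
    by_cases h : j ∈ Finset.univ.erase i
    · simp only [fill, h, dite_true]
      exact measurable_pi_apply _
    · simp only [fill, h, dite_false]
      exact measurable_const
  have h := hind.indepFun_finset (Finset.univ.erase i) {i} (by simp) hs
  have h' := h.comp (hF.comp hfill)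
    (measurable_pi_apply (⟨i, Finset.mem_singleton_self i⟩ : ({i} : Finset (Fin n))))
  have e : (fun ω => F (fun j => s j ω)) =
      (F ∘ fill) ∘ fun ω (j : (Finset.univ.erase i : Finset (Fin n))) => s j ω := by
    ext1 ω
    simp only [Function.comp_apply]
    rw [← hinv _ (s i ω₀)]
    congr 1
    ext1 j
    by_cases hj : j = i
    · subst hj
      simp [fill]
    · simp [fill, hj]
  rw [e]
  exact h'

lemma integrable_comp_hitCount (hs : ∀ i, Measurable (s i)) (hA : MeasurableSet A)
    (G : ℕ → ℝ) (hG : ∀ k, |G k| ≤ 1) :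
    Integrable (fun ω => G (hitCount A (fun i => s i ω))) P := by
  refine Integrable.of_bound (C := 1) ?_ (ae_of_all _ fun ω => hG _)
  exact ((measurable_of_countable G).comp
    ((measurable_hitCount hA).comp (measurable_pi_iff.2 hs))).aestronglyMeasurable

/-- Leaving out the `i`-th observation: on `{s i ∈ A}` the count is one plus the count of the other
observations, which is independent of `s i`. -/
lemma integral_hitCount_mul (hs : ∀ i, Measurable (s i)) (hind : iIndepFun s P)
    (hA : MeasurableSet A) (G : ℕ → ℝ) (i : Fin n) {f : β → ℝ} (hf : Measurable f)
    (hfA : ∀ x, x ∉ A → f x = 0) :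
    ∫ ω, G (hitCount A (fun i => s i ω)) * f (s i ω) ∂P =
      (∫ ω, G (hitCountErase A i (fun i => s i ω) + 1) ∂P) * ∫ ω, f (s i ω) ∂P := by
  have e (ω : Ω) : G (hitCount A (fun i => s i ω)) * f (s i ω) =
      G (hitCountErase A i (fun i => s i ω) + 1) * f (s i ω) := by
    by_cases h : s i ω ∈ A
    · rw [hitCount_of_mem (t := fun i => s i ω) h]
    · rw [hfA _ h, mul_zero, mul_zero]
  simp_rw [e]
  have hF : Measurable fun t : Fin n → β => G (hitCountErase A i t + 1) :=
    (measurable_of_countable fun k => G (k + 1)).comp (measurable_hitCountErase hA i)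
  have hI := (indepFun_of_update hs hind i hF
    (fun t b => by simp only [hitCountErase_update])).comp measurable_id hf
  exact hI.integral_fun_mul_eq_mul_integral
    (hF.comp (measurable_pi_iff.2 hs)).aestronglyMeasurable
    (hf.comp (hs i)).aestronglyMeasurable

/-- The inverse moment of a binomial variable. -/
lemma integral_inv_hitCount_add_one_le (hs : ∀ i, Measurable (s i)) (hind : iIndepFun s P)
    (hA : MeasurableSet A) {q : ℝ} (hq : ∀ i, P.real (s i ⁻¹' A) = q) (hn : 0 < n) (hq0 : 0 < q) :
    ∫ ω, ((hitCount A (fun i => s i ω) : ℝ) + 1)⁻¹ ∂P ≤ 1 / (n * q) := by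
  have hone : Measurable (A.indicator (fun _ => (1 : ℝ))) := measurable_const.indicator hA
  have hG1 : ∀ k : ℕ, |((k : ℝ) + 1)⁻¹| ≤ 1 := fun k => by
    rw [abs_of_nonneg (by positivity)]
    exact inv_le_one_of_one_le₀ (by linarith [(Nat.cast_nonneg k : (0 : ℝ) ≤ k)])
  have hG0 : ∀ k : ℕ, |((k : ℝ))⁻¹| ≤ 1 := fun k => by
    rw [abs_of_nonneg (by positivity)]
    exact Nat.cast_inv_le_one k
  have hterm (i : Fin n) : q * ∫ ω, ((hitCount A (fun i => s i ω) : ℝ) + 1)⁻¹ ∂P ≤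
      ∫ ω, (hitCount A (fun i => s i ω) : ℝ)⁻¹ * A.indicator (fun _ => (1 : ℝ)) (s i ω) ∂P := by
    rw [integral_hitCount_mul hs hind hA (fun k => (k : ℝ)⁻¹) i hone
      (fun x hx => Set.indicator_of_notMem hx _), integral_indicator_one_comp (hs i) hA, hq,
      mul_comm]
    refine mul_le_mul_of_nonneg_right (integral_mono
      (integrable_comp_hitCount hs hA (fun k => ((k : ℝ) + 1)⁻¹) hG1) ?_ fun ω => ?_) hq0.le
    · refine Integrable.of_bound (C := 1) ?_ (ae_of_all _ fun ω => hG0 _)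
      exact ((measurable_of_countable fun k : ℕ => (((k + 1 : ℕ) : ℝ))⁻¹).comp
        ((measurable_hitCountErase hA i).comp (measurable_pi_iff.2 hs))).aestronglyMeasurable
    · simp only [Nat.cast_add, Nat.cast_one]
      have := hitCountErase_le A i (fun i => s i ω)
      gcongr
  have hsum : (n : ℝ) * (q * ∫ ω, ((hitCount A (fun i => s i ω) : ℝ) + 1)⁻¹ ∂P) ≤ 1 := by
    calc _ = ∑ _i : Fin n, q * ∫ ω, ((hitCount A (fun i => s i ω) : ℝ) + 1)⁻¹ ∂P := by simp
      _ ≤ ∑ i : Fin n, ∫ ω, (hitCount A (fun i => s i ω) : ℝ)⁻¹ *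
            A.indicator (fun _ => (1 : ℝ)) (s i ω) ∂P := Finset.sum_le_sum fun i _ => hterm i
      _ = ∫ ω, ∑ i : Fin n, (hitCount A (fun i => s i ω) : ℝ)⁻¹ *
            A.indicator (fun _ => (1 : ℝ)) (s i ω) ∂P := by
          rw [integral_finsetSum]
          intro i _
          refine (integrable_comp_hitCount hs hA (fun k => (k : ℝ)⁻¹) hG0).mul_bdd (c := 1)
            (hone.comp (hs i)).aestronglyMeasurable
            (ae_of_all _ fun ω => (norm_indicator_le_norm_self _ _).trans (by simp))
      _ ≤ ∫ _, (1 : ℝ) ∂P := by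
          refine integral_mono_of_nonneg (ae_of_all _ fun ω => Finset.sum_nonneg fun i _ =>
            mul_nonneg (by positivity) (Set.indicator_nonneg (by simp) _)) (by simp)
            (ae_of_all _ fun ω => ?_)
          simp only
          rw [← Finset.mul_sum, sum_indicator_eq_hitCount A (fun i => s i ω)]
          exact inv_mul_le_one
      _ = 1 := by simp
  have hn' : (0 : ℝ) < n := by exact_mod_cast hn
  rw [le_div_iff₀ (by positivity)]
  linarith

/-- A binomial variable is rarely small: Markov's inequality for the inverse of the count. -/
lemma prob_hitCount_le (hs : ∀ i, Measurable (s i)) (hind : iIndepFun s P)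
    (hA : MeasurableSet A) {q : ℝ} (hq : ∀ i, P.real (s i ⁻¹' A) = q) (hn : 0 < n) (hq0 : 0 < q)
    {θ : ℝ} (hθ : 0 ≤ θ) :
    P.real {ω | (hitCount A (fun i => s i ω) : ℝ) ≤ θ} ≤ (θ + 1) / (n * q) := by
  have hG1 : ∀ k : ℕ, |((k : ℝ) + 1)⁻¹| ≤ 1 := fun k => by
    rw [abs_of_nonneg (by positivity)]
    exact inv_le_one_of_one_le₀ (by linarith [(Nat.cast_nonneg k : (0 : ℝ) ≤ k)])
  have hi := integral_inv_hitCount_add_one_le hs hind hA hq hn hq0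
  have hm := mul_meas_ge_le_integral_of_nonneg (μ := P)
    (f := fun ω => ((hitCount A (fun i => s i ω) : ℝ) + 1)⁻¹)
    (ae_of_all _ fun ω => by simp only [Pi.zero_apply]; positivity)
    (integrable_comp_hitCount hs hA (fun k => ((k : ℝ) + 1)⁻¹) hG1) (θ + 1)⁻¹
  have e : {ω | (θ + 1)⁻¹ ≤ ((hitCount A (fun i => s i ω) : ℝ) + 1)⁻¹} =
      {ω | (hitCount A (fun i => s i ω) : ℝ) ≤ θ} := by
    ext ω
    simp only [Set.mem_ofPred_eq]
    rw [inv_le_inv₀ (by positivity) (by positivity)]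
    exact add_le_add_iff_right 1
  rw [e] at hm
  have := hm.trans hi
  rw [inv_mul_le_iff₀ (by positivity)] at this
  rw [div_eq_mul_one_div]
  exact this

variable {E : Type*} [NormedAddCommGroup E] [InnerProductSpace ℝ E] [CompleteSpace E]
  [MeasurableSpace E] [BorelSpace E] [SecondCountableTopology E]

/-- Second moment of a sum weighted by a function of the count of nonzero summands: the cross terms
vanish, because each summand is centred and independent of the other observations. -/
lemma integral_hitCount_mul_norm_sum_sq (hs : ∀ i, Measurable (s i)) (hind : iIndepFun s P)
    (hA : MeasurableSet A) {q D : ℝ} (hq : ∀ i, P.real (s i ⁻¹' A) = q) {ξ : β → E}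
    (hξ : Measurable ξ) (hξA : ∀ x, x ∉ A → ξ x = 0) (hL2 : ∀ i, MemLp (fun ω => ξ (s i ω)) 2 P)
    (hmean : ∀ i, ∫ ω, ξ (s i ω) ∂P = 0) (hsq : ∀ i, ∫ ω, ‖ξ (s i ω)‖ ^ 2 ∂P = q * D)
    (G : ℕ → ℝ) (hG : ∀ k, |G k| ≤ 1) :
    ∫ ω, G (hitCount A (fun i => s i ω)) * ‖∑ i, ξ (s i ω)‖ ^ 2 ∂P =
      D * ∫ ω, G (hitCount A (fun i => s i ω)) * hitCount A (fun i => s i ω) ∂P := by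
  have hone : Measurable (A.indicator (fun _ => (1 : ℝ))) := measurable_const.indicator hA
  have hGm : AEStronglyMeasurable (fun ω => G (hitCount A (fun i => s i ω))) P :=
    (integrable_comp_hitCount hs hA G hG).aestronglyMeasurable
  have hcross (i j : Fin n) (hij : j ≠ i) :
      ∫ ω, G (hitCount A (fun i => s i ω)) * ⟪ξ (s j ω), ξ (s i ω)⟫ ∂P = 0 := by
    have e (ω : Ω) : G (hitCount A (fun i => s i ω)) * ⟪ξ (s j ω), ξ (s i ω)⟫ =
        innerSL ℝ (G (hitCountErase A i (fun i => s i ω) + 1) • ξ (s j ω)) (ξ (s i ω)) := by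
      rw [innerSL_apply_apply, real_inner_smul_left]
      by_cases h : s i ω ∈ A
      · rw [hitCount_of_mem (t := fun i => s i ω) h]
      · simp [hξA _ h]
    simp_rw [e]
    have hF : Measurable fun t : Fin n → β => G (hitCountErase A i t + 1) :=
      (measurable_of_countable fun k => G (k + 1)).comp (measurable_hitCountErase hA i)
    have hF' : Measurable fun t : Fin n → β => G (hitCountErase A i t + 1) • ξ (t j) :=
      hF.smul (hξ.comp (measurable_pi_apply j))
    have hI := (indepFun_of_update hs hind i hF' (fun t b => by
      simp only [hitCountErase_update, Function.update_of_ne hij])).comp measurable_id hξ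
    have := hI.integral_bilin (B := innerSL ℝ)
      (((hL2 j).integrable one_le_two).bdd_smul 1
        (hF.comp (measurable_pi_iff.2 hs)).aestronglyMeasurable (ae_of_all _ fun ω => hG _))
      ((hL2 i).integrable one_le_two)
    refine this.trans ?_
    have h0 : ∫ ω, (ξ ∘ s i) ω ∂P = 0 := hmean i
    rw [h0, map_zero]
  have hdiag (i : Fin n) : ∫ ω, G (hitCount A (fun i => s i ω)) * ⟪ξ (s i ω), ξ (s i ω)⟫ ∂P =
      D * ∫ ω, G (hitCount A (fun i => s i ω)) * A.indicator (fun _ => (1 : ℝ)) (s i ω) ∂P := by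
    simp_rw [real_inner_self_eq_norm_sq]
    rw [integral_hitCount_mul hs hind hA G i (f := fun x => ‖ξ x‖ ^ 2) (hξ.norm.pow_const 2)
        (fun x hx => by simp [hξA x hx]),
      integral_hitCount_mul hs hind hA G i hone (fun x hx => Set.indicator_of_notMem hx _),
      integral_indicator_one_comp (hs i) hA, hq, hsq]
    ring
  have hint (i j : Fin n) :
      Integrable (fun ω => G (hitCount A (fun i => s i ω)) * ⟪ξ (s j ω), ξ (s i ω)⟫) P :=
    (integrable_inner_of_memLp (hL2 j) (hL2 i)).bdd_mul (c := 1) hGm (ae_of_all _ fun ω => hG _)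
  have hint1 (i : Fin n) : Integrable (fun ω => G (hitCount A (fun i => s i ω)) *
      A.indicator (fun _ => (1 : ℝ)) (s i ω)) P := by
    refine (integrable_comp_hitCount hs hA G hG).mul_bdd (c := 1)
      (hone.comp (hs i)).aestronglyMeasurable
      (ae_of_all _ fun ω => (norm_indicator_le_norm_self _ _).trans (by simp))
  calc ∫ ω, G (hitCount A (fun i => s i ω)) * ‖∑ i, ξ (s i ω)‖ ^ 2 ∂P
      = ∫ ω, ∑ i, ∑ j, G (hitCount A (fun i => s i ω)) * ⟪ξ (s j ω), ξ (s i ω)⟫ ∂P := by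
        congr 1 with ω
        rw [← real_inner_self_eq_norm_sq, inner_sum, Finset.mul_sum]
        simp_rw [sum_inner, Finset.mul_sum]
    _ = ∑ i, ∑ j, ∫ ω, G (hitCount A (fun i => s i ω)) * ⟪ξ (s j ω), ξ (s i ω)⟫ ∂P := by
        rw [integral_finsetSum _ fun i _ => integrable_finsetSum _ fun j _ => hint i j]
        congr 1 with i
        rw [integral_finsetSum _ fun j _ => hint i j]
    _ = ∑ i, D * ∫ ω, G (hitCount A (fun i => s i ω)) *
          A.indicator (fun _ => (1 : ℝ)) (s i ω) ∂P := by
        congr 1 with i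
        rw [Finset.sum_eq_single i (fun j _ hji => hcross i j hji) (by simp), hdiag]
    _ = D * ∫ ω, G (hitCount A (fun i => s i ω)) * hitCount A (fun i => s i ω) ∂P := by
        rw [← Finset.mul_sum, ← integral_finsetSum _ fun i _ => hint1 i]
        simp_rw [← Finset.mul_sum, fun ω => sum_indicator_eq_hitCount A (fun i => s i ω)]

/-- Error of a thresholded empirical mean: the error `‖N⁻¹ ∑ ξ_i‖` of the mean of the `N` relevant
observations counts if `N > θ`, and an error `b` is charged otherwise. The first bound holds if
`N > θ` forces `N ≥ D`, the second one uses the inverse moment of `N`. -/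
lemma integral_thresholded_error_le (hs : ∀ i, Measurable (s i)) (hind : iIndepFun s P)
    (hA : MeasurableSet A) {q D : ℝ} (hq : ∀ i, P.real (s i ⁻¹' A) = q) {ξ : β → E}
    (hξ : Measurable ξ) (hξA : ∀ x, x ∉ A → ξ x = 0) (hL2 : ∀ i, MemLp (fun ω => ξ (s i ω)) 2 P)
    (hmean : ∀ i, ∫ ω, ξ (s i ω) ∂P = 0) (hsq : ∀ i, ∫ ω, ‖ξ (s i ω)‖ ^ 2 ∂P = q * D)
    (hn : 0 < n) (hq0 : 0 < q) (hD : 0 ≤ D) {θ b : ℝ} (hθ : 0 ≤ θ)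
    (hDθ : ∀ k : ℕ, k ≤ n → θ < k → D ≤ k) {δ : Ω → ℝ}
    (hδ : ∀ ω, δ ω = if θ < hitCount A (fun i => s i ω) then
      ‖(hitCount A (fun i => s i ω) : ℝ)⁻¹ • ∑ i, ξ (s i ω)‖ else b) :
    Integrable δ P ∧
    ∫ ω, δ ω ∂P ≤ 1 + b * P.real {ω | (hitCount A (fun i => s i ω) : ℝ) ≤ θ} ∧
    ∫ ω, δ ω ∂P ≤ √(2 * D / (n * q)) + b * P.real {ω | (hitCount A (fun i => s i ω) : ℝ) ≤ θ} := by
  have hc : Measurable fun ω => hitCount A (fun i => s i ω) :=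
    (measurable_hitCount hA).comp (measurable_pi_iff.2 hs)
  have hc' : Measurable fun ω => (hitCount A (fun i => s i ω) : ℝ) :=
    measurable_from_nat.comp hc
  have hS : MeasurableSet {ω | (hitCount A (fun i => s i ω) : ℝ) ≤ θ} :=
    measurableSet_le hc' measurable_const
  -- the square of the weight of the sum of the residuals
  let G : ℕ → ℝ := fun k => if θ < k then ((k : ℝ)⁻¹) ^ 2 else 0
  have hG (k : ℕ) : |G k| ≤ 1 := by
    simp only [G]
    split_ifs
    · rw [abs_of_nonneg (by positivity)]
      exact pow_le_one₀ (by positivity) (Nat.cast_inv_le_one k)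
    · simp
  let f : Ω → ℝ := fun ω => if θ < hitCount A (fun i => s i ω) then
      ‖(hitCount A (fun i => s i ω) : ℝ)⁻¹ • ∑ i, ξ (s i ω)‖ else 0
  have hsum : MemLp (fun ω => ∑ i, ξ (s i ω)) 2 P := memLp_finsetSum _ fun i _ => hL2 i
  have hfm : Measurable f := by
    refine Measurable.ite (measurableSet_lt measurable_const hc') ?_ measurable_const
    exact (hc'.inv.smul (Finset.measurable_sum _ fun i _ => hξ.comp (hs i))).norm
  have hfL2 : MemLp f 2 P := by
    refine hsum.of_le hfm.aestronglyMeasurable (ae_of_all _ fun ω => ?_)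
    simp only [f]
    split_ifs
    · rw [norm_norm, norm_smul, Real.norm_of_nonneg (by positivity)]
      exact mul_le_of_le_one_left (norm_nonneg _) (Nat.cast_inv_le_one _)
    · simp
  have hδf : δ = fun ω => f ω +
      {ω | (hitCount A (fun i => s i ω) : ℝ) ≤ θ}.indicator (fun _ => b) ω := by
    ext ω
    rw [hδ]
    by_cases h : θ < hitCount A (fun i => s i ω)
    · simp [f, h]
    · simp [f, h, not_lt.1 h]
  have hind_int : Integrable
      ({ω | (hitCount A (fun i => s i ω) : ℝ) ≤ θ}.indicator (fun _ => b)) P :=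
    (integrable_const b).indicator hS
  have hfint := hfL2.integrable one_le_two
  have hδint : ∫ ω, δ ω ∂P = ∫ ω, f ω ∂P +
      b * P.real {ω | (hitCount A (fun i => s i ω) : ℝ) ≤ θ} := by
    rw [hδf, integral_add hfint hind_int, integral_indicator_const b hS, smul_eq_mul, mul_comm b]
  have hf2 : ∫ ω, f ω ^ 2 ∂P =
      D * ∫ ω, G (hitCount A (fun i => s i ω)) * hitCount A (fun i => s i ω) ∂P := by
    rw [← integral_hitCount_mul_norm_sum_sq hs hind hA hq hξ hξA hL2 hmean hsq G hG]
    congr 1 with ω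
    simp only [f, G]
    split_ifs
    · rw [norm_smul, Real.norm_of_nonneg (by positivity), mul_pow]
    · simp
  have hjensen : ∫ ω, f ω ∂P ≤ √(∫ ω, f ω ^ 2 ∂P) := by
    refine Real.le_sqrt_of_sq_le ?_
    have h := variance_nonneg f P
    rw [variance_eq_sub hfL2] at h
    simpa using h
  have hGk0 (k : ℕ) : 0 ≤ G k * k := by
    simp only [G]
    split_ifs <;> positivity
  have hGk1 (k : ℕ) : G k * k = if θ < k then (k : ℝ)⁻¹ else 0 := by
    simp only [G]
    split_ifs with h
    · have : (k : ℝ) ≠ 0 := (hθ.trans_lt h).ne'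
      field_simp
    · simp
  refine ⟨hδf ▸ hfint.add hind_int, ?_, ?_⟩
  · rw [hδint, add_le_add_iff_right]
    refine hjensen.trans (Real.sqrt_le_one.2 ?_)
    rw [hf2, ← integral_const_mul]
    calc _ ≤ ∫ _, (1 : ℝ) ∂P := by
          refine integral_mono_of_nonneg (ae_of_all _ fun ω => mul_nonneg hD (hGk0 _)) (by simp)
            (ae_of_all _ fun ω => ?_)
          simp only [hGk1]
          split_ifs with h
          · rw [← div_eq_mul_inv]
            exact div_le_one_of_le₀ (hDθ _ (hitCount_le _ _) h) (by positivity)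
          · simp
      _ = 1 := by simp
  · rw [hδint, add_le_add_iff_right]
    refine hjensen.trans (Real.sqrt_le_sqrt ?_)
    have hG1 : ∀ k : ℕ, |((k : ℝ) + 1)⁻¹| ≤ 1 := fun k => by
      rw [abs_of_nonneg (by positivity)]
      exact inv_le_one_of_one_le₀ (by linarith [(Nat.cast_nonneg k : (0 : ℝ) ≤ k)])
    have hi := integral_inv_hitCount_add_one_le hs hind hA hq hn hq0
    rw [hf2]
    calc _ ≤ D * ∫ ω, 2 * ((hitCount A (fun i => s i ω) : ℝ) + 1)⁻¹ ∂P := by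
          refine mul_le_mul_of_nonneg_left (integral_mono_of_nonneg
            (ae_of_all _ fun ω => hGk0 _) ((integrable_comp_hitCount hs hA
              (fun k => ((k : ℝ) + 1)⁻¹) hG1).const_mul 2) (ae_of_all _ fun ω => ?_)) hD
          simp only [hGk1]
          split_ifs with h
          · have h1 : (1 : ℝ) ≤ hitCount A (fun i => s i ω) := by
              exact_mod_cast Nat.one_le_iff_ne_zero.2 fun h0 => by
                rw [h0, Nat.cast_zero] at h
                exact absurd h (not_lt.2 hθ)
            rw [← div_eq_mul_inv, inv_eq_one_div, div_le_div_iff₀ (by linarith) (by linarith)]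
            linarith
          · positivity
      _ ≤ D * (2 * (1 / (n * q))) := by
          rw [integral_const_mul]
          gcongr
      _ = 2 * D / (n * q) := by ring

end SelfNormalised

/-! ### Incomplete inputs -/

section IncompleteInputs

variable {d n : ℕ}

open Classical in
/-- The observed part of an incomplete input with pattern `m`; it is `0` for the other patterns. -/
noncomputable def obsAt (m : Pattern d) (z : ObsInput d) : ObsSpace m :=
  if h : z.1 = m then h ▸ z.2 else 0

lemma obsAt_mk (m : Pattern d) (v : ObsSpace m) : obsAt m ⟨m, v⟩ = v := by
  simp [obsAt]

lemma obsAt_observe {x : EuclideanSpace ℝ (Fin d)} {m m' : Pattern d} (h : m' = m) :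
    obsAt m (observe x m') = restrict m x := by
  subst h
  exact obsAt_mk _ _

lemma measurableSet_obsInput {s : Set (ObsInput d)} :
    MeasurableSet s ↔ ∀ m, MeasurableSet (Sigma.mk m ⁻¹' s) := by
  rw [Sigma.instMeasurableSpace, MeasurableSpace.measurableSet_iInf]
  rfl

lemma measurable_obsInput {β : Type*} [MeasurableSpace β] {f : ObsInput d → β}
    (h : ∀ m, Measurable fun v => f ⟨m, v⟩) : Measurable f :=
  fun _ hs => measurableSet_obsInput.2 fun m => h m hs

lemma measurable_sigmaMk (m : Pattern d) :
    Measurable (Sigma.mk m : ObsSpace m → ObsInput d) :=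
  fun _ hs => measurableSet_obsInput.1 hs m

lemma measurable_pattern : Measurable (fun z : ObsInput d => z.1) :=
  measurable_obsInput fun _ => measurable_const

lemma measurable_obsAt (m : Pattern d) : Measurable (obsAt m) := by
  refine measurable_obsInput fun m' => ?_
  by_cases h : m' = m
  · subst h
    simp_rw [obsAt_mk]
    exact measurable_id
  · simp only [obsAt, h, dite_false]
    exact measurable_const

lemma measurable_restrict (m : Pattern d) : Measurable (restrict m) := by
  unfold restrict
  fun_prop

lemma measurable_observe {Ω : Type*} [MeasurableSpace Ω] {X : Ω → EuclideanSpace ℝ (Fin d)}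
    {M : Ω → Pattern d} (hX : Measurable X) (hM : Measurable M) :
    Measurable fun ω => observe (X ω) (M ω) := by
  intro s hs
  have e : (fun ω => observe (X ω) (M ω)) ⁻¹' s =
      ⋃ m, M ⁻¹' {m} ∩ (fun ω => restrict m (X ω)) ⁻¹' (Sigma.mk m ⁻¹' s) := by
    ext ω
    simp [observe]
  rw [e]
  exact MeasurableSet.iUnion fun m => (hM (measurableSet_singleton m)).inter
    (((measurable_restrict m).comp hX) (measurableSet_obsInput.1 hs m))

instance : MeasurableSingletonClass ℤˣ where
  measurableSet_singleton k := by
    have e : {k} = Units.val ⁻¹' {(k : ℤ)} := by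
      ext y
      simp [Units.ext_iff]
    rw [e]
    exact comap_measurable Units.val (measurableSet_singleton _)

/-- The observations with pattern `m` and label `k`. -/
def cell (m : Pattern d) (k : ℤˣ) : Set (ObsInput d × ℤˣ) := {q | q.1.1 = m ∧ q.2 = k}

lemma measurableSet_cell (m : Pattern d) (k : ℤˣ) : MeasurableSet (cell m k) :=
  ((measurable_pattern.comp measurable_fst) (measurableSet_singleton m)).inter
    (measurable_snd (measurableSet_singleton k))

lemma classCount_eq_hitCount (X : Fin n → EuclideanSpace ℝ (Fin d)) (M : Fin n → Pattern d)
    (Y : Fin n → ℤˣ) (m : Pattern d) (k : ℤˣ) :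
    classCount M Y m k = hitCount (cell m k) (fun i => (observe (X i) (M i), Y i)) := by
  rw [classCount, hitCount]
  congr

/-- The thresholded mean as a function of the incomplete sample. -/
noncomputable def sampleMean (τ : ℝ) (m : Pattern d) (k : ℤˣ)
    (t : Fin n → ObsInput d × ℤˣ) : ObsSpace m :=
  if n * τ < hitCount (cell m k) t then
    (hitCount (cell m k) t : ℝ)⁻¹ • ∑ i, (cell m k).indicator (fun q => obsAt m q.1) (t i)
  else 0

lemma measurable_sampleMean (τ : ℝ) (m : Pattern d) (k : ℤˣ) :
    Measurable (sampleMean τ m k : (Fin n → ObsInput d × ℤˣ) → ObsSpace m) := by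
  have hc : Measurable fun t : Fin n → ObsInput d × ℤˣ => (hitCount (cell m k) t : ℝ) :=
    measurable_from_nat.comp (measurable_hitCount (measurableSet_cell m k))
  refine Measurable.ite (measurableSet_lt measurable_const hc) ?_ measurable_const
  refine hc.inv.smul (Finset.measurable_sum _ fun i _ => ?_)
  exact (((measurable_obsAt m).comp measurable_fst).indicator (measurableSet_cell m k)).comp
    (measurable_pi_apply i)

lemma thresholdedMean_eq_sampleMean (hn : 0 < n) (τ : ℝ) (X : Fin n → EuclideanSpace ℝ (Fin d))
    (M : Fin n → Pattern d) (Y : Fin n → ℤˣ) (m : Pattern d) (k : ℤˣ) :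
    thresholdedMean τ X M Y m k =
      sampleMean τ m k (fun i => (observe (X i) (M i), Y i)) := by
  have hn' : (0 : ℝ) < n := by exact_mod_cast hn
  rw [thresholdedMean, sampleMean, classMean, classCount_eq_hitCount X]
  have hsum : ∑ i ∈ Finset.univ.filter (fun i => M i = m ∧ Y i = k), restrict m (X i) =
      ∑ i, (cell m k).indicator (fun q => obsAt m q.1) (observe (X i) (M i), Y i) := by
    classical
    rw [Finset.sum_filter]
    refine Finset.sum_congr rfl fun i _ => ?_
    rw [Set.indicator_apply]
    by_cases h : M i = m ∧ Y i = k
    · rw [if_pos h, if_pos (show _ ∈ cell m k from h), obsAt_observe h.1]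
    · rw [if_neg h, if_neg (show _ ∉ cell m k from h)]
  rw [hsum]
  simp only [lt_div_iff₀ hn', mul_comm τ]

/-- The whitened centred observation of the cell `(m, k)`, zero outside of the cell. -/
noncomputable def whitenedResidual (Sigma : (m : Pattern d) → Matrix (ObsIdx m) (ObsIdx m) ℝ)
    (m : Pattern d) (k : ℤˣ) (u : ObsSpace m) : ObsInput d × ℤˣ → ObsSpace m :=
  (cell m k).indicator fun q => whiten (Sigma m) (obsAt m q.1 - u)

lemma measurable_whitenedResidual (Sigma : (m : Pattern d) → Matrix (ObsIdx m) (ObsIdx m) ℝ)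
    (m : Pattern d) (k : ℤˣ) (u : ObsSpace m) : Measurable (whitenedResidual Sigma m k u) :=
  ((whiten (Sigma m)).measurable.comp
    (((measurable_obsAt m).comp measurable_fst).sub_const u)).indicator (measurableSet_cell m k)

lemma norm_whiten_sampleMean_sub (Sigma : (m : Pattern d) → Matrix (ObsIdx m) (ObsIdx m) ℝ)
    {τ : ℝ} (hτ : 0 ≤ τ) (m : Pattern d) (k : ℤˣ) (u : ObsSpace m)
    (t : Fin n → ObsInput d × ℤˣ) :
    ‖whiten (Sigma m) (sampleMean τ m k t - u)‖ =
      if n * τ < hitCount (cell m k) t then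
        ‖(hitCount (cell m k) t : ℝ)⁻¹ • ∑ i, whitenedResidual Sigma m k u (t i)‖
      else ‖whiten (Sigma m) u‖ := by
  rw [sampleMean]
  split_ifs with h
  · have hpos : (0 : ℝ) < hitCount (cell m k) t := lt_of_le_of_lt (by positivity) h
    congr 1
    have e (q : ObsInput d × ℤˣ) : whitenedResidual Sigma m k u q =
        whiten (Sigma m) ((cell m k).indicator (fun q => obsAt m q.1) q) -
          (cell m k).indicator (fun _ => (1 : ℝ)) q • whiten (Sigma m) u := by
      classical
      rw [whitenedResidual, Set.indicator_apply, Set.indicator_apply, Set.indicator_apply]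
      split_ifs <;> simp
    simp_rw [e]
    rw [Finset.sum_sub_distrib, ← Finset.sum_smul, sum_indicator_eq_hitCount, smul_sub, smul_smul,
      inv_mul_cancel₀ hpos.ne', one_smul, map_sub, map_smul, map_sum]
  · rw [zero_sub, map_neg, norm_neg]

lemma whitenedResidual_comp {Ω : Type*} (X : Ω → EuclideanSpace ℝ (Fin d)) (M : Ω → Pattern d)
    (Y : Ω → ℤˣ) (Sigma : (m : Pattern d) → Matrix (ObsIdx m) (ObsIdx m) ℝ)
    (m : Pattern d) (k : ℤˣ) (u : ObsSpace m) (ω : Ω) :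
    whitenedResidual Sigma m k u (observe (X ω) (M ω), Y ω) =
      {ω | M ω = m ∧ Y ω = k}.indicator (fun ω => whiten (Sigma m) (restrict m (X ω) - u)) ω := by
  classical
  rw [whitenedResidual, Set.indicator_apply, Set.indicator_apply]
  by_cases h : M ω = m ∧ Y ω = k
  · rw [if_pos (show _ ∈ cell m k from h), if_pos (show ω ∈ {ω | M ω = m ∧ Y ω = k} from h),
      obsAt_observe h.1]
  · rw [if_neg (show _ ∉ cell m k from h), if_neg (show ω ∉ {ω | M ω = m ∧ Y ω = k} from h)]

end IncompleteInputs

/-! ### The laws of the cells -/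

section Model

variable {Ω : Type*} [MeasurableSpace Ω] {P : Measure Ω} {d n : ℕ}
  {X : Ω → EuclideanSpace ℝ (Fin d)} {M : Ω → Pattern d} {Y : Ω → ℤˣ}
  {mu : (m : Pattern d) → ℤˣ → ObsSpace m}
  {Sigma : (m : Pattern d) → Matrix (ObsIdx m) (ObsIdx m) ℝ}

/-- Given the class and the pattern, the whitened residual is standard Gaussian. -/
lemma map_cond_whiten (hmodel : IsBalancedGPMMLDA P X M Y mu Sigma) (hX : Measurable X)
    {m : Pattern d} (hm : P {ω | M ω = m} ≠ 0) (k : ℤˣ) :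
    (P[|{ω | M ω = m ∧ Y ω = k}]).map (fun ω => whiten (Sigma m) (restrict m (X ω) - mu m k)) =
      stdGaussian (ObsSpace m) := by
  rw [← map_whiten_multivariateGaussian (hmodel.posDef m hm) (mu m k), ← hmodel.gaussian m hm k,
    Measure.map_map (f := fun ω => restrict m (X ω)) (by fun_prop)
      ((measurable_restrict m).comp hX)]
  rfl

lemma measurableSet_class (hM : Measurable M) (hY : Measurable Y) (m : Pattern d) (k : ℤˣ) :
    MeasurableSet {ω | M ω = m ∧ Y ω = k} :=
  (hM (measurableSet_singleton m)).inter (hY (measurableSet_singleton k))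

variable [IsProbabilityMeasure P]

lemma class_prob (hmodel : IsBalancedGPMMLDA P X M Y mu Sigma) (hM : Measurable M)
    (hY : Measurable Y) (m : Pattern d) (k : ℤˣ) :
    P.real {ω | M ω = m ∧ Y ω = k} = patternProb P M m / 2 := by
  have h1 : P.real {ω | M ω = m ∧ Y ω = 1} = P.real {ω | M ω = m ∧ Y ω = -1} := by
    rw [measureReal_def, hmodel.balanced m, measureReal_def]
  have hU : {ω | M ω = m} = {ω | M ω = m ∧ Y ω = 1} ∪ {ω | M ω = m ∧ Y ω = -1} := by
    ext ω
    have := Int.units_eq_one_or (Y ω)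
    simp only [Set.mem_union, Set.mem_ofPred_eq]
    tauto
  have h2 : patternProb P M m =
      P.real {ω | M ω = m ∧ Y ω = 1} + P.real {ω | M ω = m ∧ Y ω = -1} := by
    rw [patternProb, hU, measureReal_union _ (measurableSet_class hM hY m (-1))]
    rw [Set.disjoint_left]
    rintro ω ⟨_, h⟩ ⟨_, h'⟩
    rw [h] at h'
    exact absurd h' (by decide)
  rcases Int.units_eq_one_or k with rfl | rfl <;> linarith

lemma class_inter_prob (hmodel : IsBalancedGPMMLDA P X M Y mu Sigma) (hX : Measurable X)
    (hM : Measurable M) (hY : Measurable Y) {m : Pattern d} (hm : P {ω | M ω = m} ≠ 0) (k : ℤˣ)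
    {T : Set (ObsSpace m)} (hT : MeasurableSet T) :
    P.real ({ω | M ω = m ∧ Y ω = k} ∩ {ω | restrict m (X ω) ∈ T}) =
      patternProb P M m / 2 * (multivariateGaussian (mu m k) (Sigma m)).real T := by
  rw [← hmodel.gaussian m hm k, map_measureReal_apply (f := fun ω => restrict m (X ω))
      ((measurable_restrict m).comp hX) hT, ← class_prob hmodel hM hY m k, mul_comm]
  rw [measureReal_def, measureReal_def, measureReal_def, ← ENNReal.toReal_mul]
  exact congrArg ENNReal.toReal (cond_mul_eq_inter (measurableSet_class hM hY m k) _ P).symm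

/-- The risk on the pattern `m` of a prediction that, there, is the indicator of a set `T` of
observed inputs. -/
lemma pattern_risk_eq (hmodel : IsBalancedGPMMLDA P X M Y mu Sigma) (hX : Measurable X)
    (hM : Measurable M) (hY : Measurable Y) {m : Pattern d} (hm : P {ω | M ω = m} ≠ 0)
    {T : Set (ObsSpace m)} (hT : MeasurableSet T) {H : Ω → ℤˣ}
    (hH : ∀ ω, M ω = m → (H ω = 1 ↔ restrict m (X ω) ∈ T)) :
    P.real {ω | M ω = m ∧ Y ω ≠ H ω} = patternProb P M m / 2 *
      ((multivariateGaussian (mu m 1) (Sigma m)).real Tᶜ +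
        (multivariateGaussian (mu m (-1)) (Sigma m)).real T) := by
  have e : {ω | M ω = m ∧ Y ω ≠ H ω} =
      ({ω | M ω = m ∧ Y ω = 1} ∩ {ω | restrict m (X ω) ∈ Tᶜ}) ∪
        ({ω | M ω = m ∧ Y ω = -1} ∩ {ω | restrict m (X ω) ∈ T}) := by
    ext ω
    simp only [Set.mem_union, Set.mem_inter_iff, Set.mem_ofPred_eq, Set.mem_compl_iff]
    by_cases h : M ω = m
    · rw [← hH ω h]
      have hne : (1 : ℤˣ) ≠ -1 := by decide
      rcases Int.units_eq_one_or (Y ω) with h1 | h1 <;>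
        rcases Int.units_eq_one_or (H ω) with h2 | h2 <;> simp [h, h1, h2, hne, hne.symm]
    · simp [h]
  rw [e, measureReal_union, class_inter_prob hmodel hX hM hY hm 1 hT.compl,
    class_inter_prob hmodel hX hM hY hm (-1) hT, mul_add]
  · rw [Set.disjoint_left]
    rintro ω ⟨⟨_, h⟩, _⟩ ⟨⟨_, h'⟩, _⟩
    rw [h] at h'
    exact absurd h' (by decide)
  · exact (measurableSet_class hM hY m (-1)).inter (((measurable_restrict m).comp hX) hT)

lemma restrict_eq_smul_cond {s : Set Ω} (hs : P s ≠ 0) : P.restrict s = P s • P[|s] := by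
  rw [ProbabilityTheory.cond, smul_smul, ENNReal.mul_inv_cancel hs (by finiteness), one_smul]

/-- First two moments of the whitened residual. -/
lemma whitenedResidual_moments (hmodel : IsBalancedGPMMLDA P X M Y mu Sigma) (hX : Measurable X)
    (hM : Measurable M) (hY : Measurable Y) {m : Pattern d} (hm : P {ω | M ω = m} ≠ 0) (k : ℤˣ) :
    MemLp (fun ω => whitenedResidual Sigma m k (mu m k) (observe (X ω) (M ω), Y ω)) 2 P ∧
    ∫ ω, whitenedResidual Sigma m k (mu m k) (observe (X ω) (M ω), Y ω) ∂P = 0 ∧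
    ∫ ω, ‖whitenedResidual Sigma m k (mu m k) (observe (X ω) (M ω), Y ω)‖ ^ 2 ∂P =
      patternProb P M m / 2 * Fintype.card (ObsIdx m) := by
  have hB := measurableSet_class hM hY m k
  have hζ : Measurable fun ω => whiten (Sigma m) (restrict m (X ω) - mu m k) :=
    (whiten (Sigma m)).measurable.comp (((measurable_restrict m).comp hX).sub_const _)
  have hp : 0 < patternProb P M m := by
    rw [patternProb, measureReal_def]
    exact ENNReal.toReal_pos hm (by finiteness)
  have hPB : P {ω | M ω = m ∧ Y ω = k} ≠ 0 := by
    intro h0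
    have h := class_prob hmodel hM hY m k
    rw [measureReal_def, h0, ENNReal.toReal_zero] at h
    linarith
  have hmap := map_cond_whiten hmodel hX hm k
  have hmem : MemLp (fun ω => whiten (Sigma m) (restrict m (X ω) - mu m k)) 2
      (P[|{ω | M ω = m ∧ Y ω = k}]) := by
    have h : MemLp id 2 (stdGaussian (ObsSpace m)) := IsGaussian.memLp_two_id
    rw [← hmap, memLp_map_measure_iff (by fun_prop) hζ.aemeasurable] at h
    exact h
  simp_rw [whitenedResidual_comp]
  refine ⟨?_, ?_, ?_⟩
  · rw [memLp_indicator_iff_restrict hB, restrict_eq_smul_cond hPB]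
    exact hmem.smul_measure (by finiteness)
  · rw [integral_indicator hB, restrict_eq_smul_cond hPB, integral_smul_measure]
    have h : ∫ x, id x ∂stdGaussian (ObsSpace m) = 0 := integral_id_stdGaussian
    rw [← hmap, integral_map hζ.aemeasurable (by fun_prop)] at h
    simp only [id] at h
    rw [h, smul_zero]
  · have e (ω : Ω) : ‖{ω | M ω = m ∧ Y ω = k}.indicator
        (fun ω => whiten (Sigma m) (restrict m (X ω) - mu m k)) ω‖ ^ 2 =
        {ω | M ω = m ∧ Y ω = k}.indicator
          (fun ω => ‖whiten (Sigma m) (restrict m (X ω) - mu m k)‖ ^ 2) ω := by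
      classical
      rw [Set.indicator_apply, Set.indicator_apply]
      split_ifs <;> simp
    simp_rw [e]
    rw [integral_indicator hB, restrict_eq_smul_cond hPB, integral_smul_measure]
    have h := integral_norm_sq_stdGaussian (ι := ObsIdx m)
    rw [← hmap, integral_map hζ.aemeasurable (by fun_prop)] at h
    rw [h, ← class_prob hmodel hM hY m k]
    rfl

end Model

/-! ### From the error bounds to the rate -/

section Numeric

/-- The two bounds on the error of a thresholded mean give the rate `τ ∧ p`. -/
lemma mul_error_le_min {d n D : ℕ} (hn : 0 < n) (hD : D ≤ d) {τ p B b π₀ δ : ℝ}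
    (hτ : √((d : ℝ) / n) ≤ τ) (hp : 0 < p) (hp1 : p ≤ 1) (hb : 0 ≤ b) (hbB : b ≤ B)
    (hBD : D = 0 → B = 0) (hπ0 : 0 ≤ π₀) (hπ1 : π₀ ≤ 1)
    (hπ : π₀ ≤ (n * τ + 1) / (n * (p / 2)))
    (hδ1 : δ ≤ 1 + b * π₀) (hδ2 : δ ≤ √(2 * D / (n * (p / 2))) + b * π₀) :
    p * δ ≤ (2 + 4 * B) * min τ p := by
  have hn' : (0 : ℝ) < n := by exact_mod_cast hn
  have hτ0 : 0 ≤ τ := (Real.sqrt_nonneg _).trans hτ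
  have hB : 0 ≤ B := hb.trans hbB
  have hbπ : b * π₀ ≤ B * π₀ := mul_le_mul_of_nonneg_right hbB hπ0
  have hτ2 : (d : ℝ) / n ≤ τ ^ 2 := Real.sqrt_le_left hτ0 |>.1 hτ
  rcases le_total p τ with h | h
  · rw [min_eq_right h]
    have : b * π₀ ≤ B := hbπ.trans (mul_le_of_le_one_right hB hπ1)
    nlinarith [mul_nonneg hp.le hB]
  · rw [min_eq_left h]
    have hroot : p * √(2 * D / (n * (p / 2))) ≤ 2 * τ := by
      rw [← le_div_iff₀' hp, Real.sqrt_le_left (by positivity)]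
      have hDd : (D : ℝ) ≤ d := by exact_mod_cast hD
      have hD2 : (D : ℝ) ≤ τ ^ 2 * n := hDd.trans ((div_le_iff₀ hn').1 hτ2)
      rw [div_pow, div_le_div_iff₀ (by positivity) (by positivity)]
      have h1 : (D : ℝ) * p ≤ τ ^ 2 * n :=
        (mul_le_of_le_one_right (Nat.cast_nonneg _) hp1).trans hD2
      nlinarith [mul_le_mul_of_nonneg_right h1 hp.le]
    have hbias : p * (B * π₀) ≤ 4 * B * τ := by
      rcases Nat.eq_zero_or_pos D with h0 | hpos
      · simp [hBD h0]
      · -- as `d ≥ 1`, the threshold is at least one observation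
        have hnτ : 1 ≤ n * τ := by
          have hd1 : (1 : ℝ) ≤ d := by exact_mod_cast hpos.trans_le hD
          have h2 : 1 ≤ τ ^ 2 * n := hd1.trans ((div_le_iff₀ hn').1 hτ2)
          have hn1 : (1 : ℝ) ≤ n := by exact_mod_cast hn
          have h3 : 1 ≤ (n * τ) ^ 2 := by nlinarith
          exact (one_le_sq_iff₀ (by positivity)).1 h3
        have h4 : p * π₀ ≤ 4 * τ := by
          rw [le_div_iff₀ (by positivity)] at hπ
          nlinarith
        nlinarith
    nlinarith [mul_le_mul_of_nonneg_left hbπ hp.le]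

end Numeric

/-! ### Freezing an independent variable -/

section Independence

variable {Ω : Type*} [MeasurableSpace Ω] {P : Measure Ω} [IsProbabilityMeasure P]
  {α β : Type*} [MeasurableSpace α] [MeasurableSpace β] {U : Ω → α} {V : Ω → β}

lemma measurable_section (hU : Measurable U) (hV : Measurable V) {S : Set (α × β)}
    (hS : MeasurableSet S) : Measurable fun ω => P {ω' | (U ω, V ω') ∈ S} := by
  have h : Measurable fun ω => P.map V (Prod.mk (U ω) ⁻¹' S) :=
    (measurable_measure_prodMk_left (ν := P.map V) hS).comp hU
  have e (ω : Ω) : P {ω' | (U ω, V ω') ∈ S} = P.map V (Prod.mk (U ω) ⁻¹' S) :=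
    (Measure.map_apply hV (measurable_prodMk_left hS)).symm
  simp_rw [e]
  exact h

lemma integrable_real_section (hU : Measurable U) (hV : Measurable V) {S : Set (α × β)}
    (hS : MeasurableSet S) : Integrable (fun ω => P.real {ω' | (U ω, V ω') ∈ S}) P := by
  refine Integrable.of_bound (C := 1)
    (measurable_section hU hV hS).ennreal_toReal.aestronglyMeasurable (ae_of_all _ fun ω => ?_)
  rw [Real.norm_of_nonneg measureReal_nonneg]
  exact measureReal_le_one

/-- Independence as disintegration: freeze the first variable, then integrate over it. -/
lemma indepFun_real_mem_eq_integral (h : IndepFun U V P) (hU : Measurable U) (hV : Measurable V)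
    {S : Set (α × β)} (hS : MeasurableSet S) :
    P.real {ω | (U ω, V ω) ∈ S} = ∫ ω, P.real {ω' | (U ω, V ω') ∈ S} ∂P := by
  have hmap := (indepFun_iff_map_prod_eq_prod_map_map hU.aemeasurable hV.aemeasurable).1 h
  have h1 : P {ω | (U ω, V ω) ∈ S} = ∫⁻ ω, P {ω' | (U ω, V ω') ∈ S} ∂P := by
    have h2 : P {ω | (U ω, V ω) ∈ S} = P.map (fun ω => (U ω, V ω)) S :=
      (Measure.map_apply (hU.prodMk hV) hS).symm
    rw [h2, hmap, Measure.prod_apply hS,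
      lintegral_map (measurable_measure_prodMk_left hS) hU]
    refine lintegral_congr fun ω => ?_
    rw [Measure.map_apply hV (measurable_prodMk_left hS)]
    rfl
  rw [measureReal_def, h1]
  exact (integral_toReal (measurable_section hU hV hS).aemeasurable
    (ae_of_all _ fun ω => measure_lt_top P _)).symm

end Independence

/-! ### Excess risk -/

section Risk

variable {Ω : Type*} [MeasurableSpace Ω] {P : Measure Ω} [IsProbabilityMeasure P] {d n : ℕ}
  {X : Ω → EuclideanSpace ℝ (Fin d)} {M : Ω → Pattern d} {Y : Ω → ℤˣ}
  {Xs : Fin n → Ω → EuclideanSpace ℝ (Fin d)} {Ms : Fin n → Ω → Pattern d} {Ys : Fin n → Ω → ℤˣ}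
  {mu : (m : Pattern d) → ℤˣ → ObsSpace m}
  {Sigma : (m : Pattern d) → Matrix (ObsIdx m) (ObsIdx m) ℝ}

lemma misRisk_eq_sum (hM : Measurable M) (H : Ω → ℤˣ) :
    misRisk P Y H = ∑ m, P.real {ω | M ω = m ∧ Y ω ≠ H ω} := by
  have h := sum_measureReal_preimage_singleton (μ := P.restrict {ω | Y ω ≠ H ω}) (f := M)
    Finset.univ (fun m _ => hM (measurableSet_singleton m))
  rw [Finset.coe_univ, Set.preimage_univ, measureReal_restrict_apply MeasurableSet.univ,
    Set.univ_inter] at h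
  rw [misRisk, ← h]
  refine Finset.sum_congr rfl fun m _ => ?_
  rw [measureReal_restrict_apply (hM (measurableSet_singleton m))]
  rfl

/-- On a pattern, a prediction that is measurable with respect to the incomplete input is given by a
measurable set of observed inputs. -/
lemma exists_set_bayesPrediction (P : Measure Ω) (X : Ω → EuclideanSpace ℝ (Fin d))
    (M : Ω → Pattern d) (Y : Ω → ℤˣ) (m : Pattern d) :
    ∃ T : Set (ObsSpace m), MeasurableSet T ∧ ∀ ω, M ω = m →
      (bayesPrediction P (fun ω => observe (X ω) (M ω)) Y ω = 1 ↔ restrict m (X ω) ∈ T) := by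
  set Z : Ω → ObsInput d := fun ω => observe (X ω) (M ω)
  have hmeas : MeasurableSet[MeasurableSpace.comap Z inferInstance]
      {ω | 0 ≤ (P[(fun ω' => (((Y ω' : ℤˣ) : ℤ) : ℝ)) |
        MeasurableSpace.comap Z inferInstance]) ω} :=
    stronglyMeasurable_condExp.measurable measurableSet_Ici
  obtain ⟨T₀, hT₀, hT⟩ := hmeas
  refine ⟨Sigma.mk m ⁻¹' T₀, measurable_sigmaMk m hT₀, fun ω hω => ?_⟩
  have h1 : restrict m (X ω) ∈ Sigma.mk m ⁻¹' T₀ ↔ ω ∈ Z ⁻¹' T₀ := by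
    subst hω
    rfl
  rw [h1, hT, bayesPrediction, sgn]
  split_ifs with h
  · exact iff_of_true rfl h
  · exact iff_of_false (by decide) h

/-- Mean error of the whitened thresholded mean of a cell. -/
lemma integral_whitened_error_le (hn : 0 < n) (hX : Measurable X) (hM : Measurable M)
    (hY : Measurable Y) (hXs : ∀ i, Measurable (Xs i)) (hMs : ∀ i, Measurable (Ms i))
    (hYs : ∀ i, Measurable (Ys i)) (hmodel : IsBalancedGPMMLDA P X M Y mu Sigma)
    (hsample : IsIIDSample P X M Y Xs Ms Ys) {τ : ℝ} (hτ : √((d : ℝ) / n) ≤ τ)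
    {m : Pattern d} (hm : P {ω | M ω = m} ≠ 0) (k : ℤˣ) :
    Integrable (fun ω => ‖whiten (Sigma m) (sampleMean τ m k
      (fun i => (observe (Xs i ω) (Ms i ω), Ys i ω)) - mu m k)‖) P ∧
    patternProb P M m * ∫ ω, ‖whiten (Sigma m) (sampleMean τ m k
      (fun i => (observe (Xs i ω) (Ms i ω), Ys i ω)) - mu m k)‖ ∂P ≤
      (2 + 4 * (max ‖mu m 1‖ ‖mu m (-1)‖ / √(lambdaMin (Sigma m)))) *
        min τ (patternProb P M m) := by
  have hn' : (0 : ℝ) < n := by exact_mod_cast hn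
  have hτ0 : 0 ≤ τ := (Real.sqrt_nonneg _).trans hτ
  have hp : 0 < patternProb P M m := by
    rw [patternProb, measureReal_def]
    exact ENNReal.toReal_pos hm (by finiteness)
  set s : Fin n → Ω → ObsInput d × ℤˣ := fun i ω => (observe (Xs i ω) (Ms i ω), Ys i ω)
  set s₀ : Ω → ObsInput d × ℤˣ := fun ω => (observe (X ω) (M ω), Y ω)
  have hs (i : Fin n) : Measurable (s i) := (measurable_observe (hXs i) (hMs i)).prodMk (hYs i)
  have hA := measurableSet_cell m k
  have hid (i : Fin n) : IdentDistrib (s i) s₀ P P := hsample.identDistrib i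
  set ξ := whitenedResidual Sigma m k (mu m k)
  have hξ : Measurable ξ := measurable_whitenedResidual Sigma m k (mu m k)
  obtain ⟨hL2, hmean, hsq⟩ := whitenedResidual_moments hmodel hX hM hY hm k
  have hq (i : Fin n) : P.real (s i ⁻¹' cell m k) = patternProb P M m / 2 := by
    rw [← class_prob hmodel hM hY m k, measureReal_def, (hid i).measure_mem_eq hA]
    rfl
  have hDθ (j : ℕ) (hj : j ≤ n) (h : n * τ < j) : (Fintype.card (ObsIdx m) : ℝ) ≤ j := by
    have hcard : (Fintype.card (ObsIdx m) : ℝ) ≤ d := by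
      exact_mod_cast (Fintype.card_subtype_le _).trans (by simp)
    refine hcard.trans ?_
    have hτ2 : (d : ℝ) / n ≤ τ ^ 2 := Real.sqrt_le_left hτ0 |>.1 hτ
    rw [div_le_iff₀ hn'] at hτ2
    have hj' : (j : ℝ) ≤ n := by exact_mod_cast hj
    -- otherwise `n τ > n ≥ j`
    have hτ1 : τ ≤ 1 := by
      by_contra! hcon
      nlinarith
    -- `d ≤ n τ ^ 2 ≤ n τ < j`
    nlinarith [mul_nonneg hτ0 hn'.le]
  obtain ⟨hint, hδ1, hδ2⟩ := integral_thresholded_error_le (P := P) hs hsample.iIndepFun hA hq hξ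
    (fun x hx => Set.indicator_of_notMem hx _)
    (fun i => ((hid i).comp hξ).memLp_iff.2 hL2)
    (fun i => ((hid i).comp hξ).integral_eq.trans hmean)
    (fun i => ((hid i).comp (hξ.norm.pow_const 2)).integral_eq.trans hsq)
    hn (half_pos hp) (Nat.cast_nonneg _) (mul_nonneg hn'.le hτ0) hDθ
    (fun ω => norm_whiten_sampleMean_sub Sigma hτ0 m k (mu m k) (fun i => s i ω))
  refine ⟨hint, mul_error_le_min (D := Fintype.card (ObsIdx m)) hn
    ((Fintype.card_subtype_le _).trans (by simp)) hτ hp measureReal_le_one (norm_nonneg _) ?_ ?_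
    measureReal_nonneg measureReal_le_one
    (prob_hitCount_le hs hsample.iIndepFun hA hq hn (half_pos hp) (mul_nonneg hn'.le hτ0))
    hδ1 hδ2⟩
  · refine (norm_whiten_le (hmodel.posDef m hm) _).trans ?_
    gcongr
    rcases Int.units_eq_one_or k with rfl | rfl
    · exact le_max_left _ _
    · exact le_max_right _ _
  · -- on the fully missing pattern there is no mean to estimate
    intro h0
    have : IsEmpty (ObsIdx m) := Fintype.card_eq_zero_iff.1 h0
    have hz (v : ObsSpace m) : ‖v‖ = 0 := by
      rw [Subsingleton.elim v 0, norm_zero]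
    rw [hz, hz, max_self, zero_div]

/-- Excess risk of the plug-in classifier on one pattern. -/
lemma pattern_excess_le (hn : 0 < n) (hX : Measurable X) (hM : Measurable M)
    (hY : Measurable Y) (hXs : ∀ i, Measurable (Xs i)) (hMs : ∀ i, Measurable (Ms i))
    (hYs : ∀ i, Measurable (Ys i)) (hmodel : IsBalancedGPMMLDA P X M Y mu Sigma)
    (hsample : IsIIDSample P X M Y Xs Ms Ys) {τ : ℝ} (hτ : √((d : ℝ) / n) ≤ τ) (m : Pattern d) :
    P.real {ω | M ω = m ∧ Y ω ≠ plugInClassifier Sigma τ (fun i => Xs i ω) (fun i => Ms i ω)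
        (fun i => Ys i ω) (observe (X ω) (M ω))} -
      P.real {ω | M ω = m ∧ Y ω ≠ bayesPrediction P (fun ω => observe (X ω) (M ω)) Y ω} ≤
    (4 / √(2 * Real.pi) + 8 / √Real.pi *
      (max ‖mu m 1‖ ‖mu m (-1)‖ / √(lambdaMin (Sigma m)))) * min τ (patternProb P M m) := by
  have hτ0 : 0 ≤ τ := (Real.sqrt_nonneg _).trans hτ
  set B := max ‖mu m 1‖ ‖mu m (-1)‖ / √(lambdaMin (Sigma m)) with hB_def
  have hB : 0 ≤ B := by positivity
  by_cases hm : P {ω | M ω = m} = 0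
  · have hle : P.real {ω | M ω = m ∧ Y ω ≠ plugInClassifier Sigma τ (fun i => Xs i ω)
        (fun i => Ms i ω) (fun i => Ys i ω) (observe (X ω) (M ω))} = 0 := by
      rw [measureReal_def, measure_mono_null (fun ω hω => hω.1) hm, ENNReal.toReal_zero]
    rw [hle]
    have : (0 : ℝ) ≤ P.real {ω | M ω = m ∧
      Y ω ≠ bayesPrediction P (fun ω => observe (X ω) (M ω)) Y ω} := measureReal_nonneg
    have h2 : 0 ≤ min τ (patternProb P M m) := le_min hτ0 measureReal_nonneg
    have h3 : 0 ≤ (4 / √(2 * Real.pi) + 8 / √Real.pi * B) * min τ (patternProb P M m) := by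
      positivity
    linarith
  set p := patternProb P M m with hp_def
  set s : Fin n → Ω → ObsInput d × ℤˣ := fun i ω => (observe (Xs i ω) (Ms i ω), Ys i ω)
  set s₀ : Ω → ObsInput d × ℤˣ := fun ω => (observe (X ω) (M ω), Y ω) with hs0_def
  have hs (i : Fin n) : Measurable (s i) := (measurable_observe (hXs i) (hMs i)).prodMk (hYs i)
  have hs0 : Measurable s₀ := (measurable_observe hX hM).prodMk hY
  obtain ⟨T, hT, hTiff⟩ := exists_set_bayesPrediction P X M Y m
  have hbayes := pattern_risk_eq hmodel hX hM hY hm hT hTiff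
  set RB := P.real {ω | M ω = m ∧ Y ω ≠ bayesPrediction P (fun ω => observe (X ω) (M ω)) Y ω}
  -- the pair of thresholded means, a function of the sample only
  let F : (Fin n → ObsInput d × ℤˣ) → ObsSpace m × ObsSpace m :=
    fun t => (sampleMean τ m 1 t, sampleMean τ m (-1) t)
  have hF : Measurable F := (measurable_sampleMean τ m 1).prodMk (measurable_sampleMean τ m (-1))
  let U : Ω → ObsSpace m × ObsSpace m := fun ω => F fun i => s i ω
  have hU : Measurable U := hF.comp (measurable_pi_iff.2 hs)
  have hindep : IndepFun U s₀ P := hsample.indepFun.comp hF measurable_id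
  -- the event that the rule with frozen means errs on the pattern `m`
  let S : Set ((ObsSpace m × ObsSpace m) × (ObsInput d × ℤˣ)) :=
    {q | q.2.1.1 = m ∧ q.2.2 ≠ ldaRule (Sigma m) q.1.1 q.1.2 (obsAt m q.2.1)}
  have hS : MeasurableSet S := by
    have hL : Measurable fun q : (ObsSpace m × ObsSpace m) × (ObsInput d × ℤˣ) =>
        ldaRule (Sigma m) q.1.1 q.1.2 (obsAt m q.2.1) := by
      have h1 : MeasurableSet {q : (ObsSpace m × ObsSpace m) × (ObsInput d × ℤˣ) |
          ldaRule (Sigma m) q.1.1 q.1.2 (obsAt m q.2.1) = 1} :=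
        (measurableSet_ldaRule_eq_one (Sigma m)).preimage
          (f := fun q : (ObsSpace m × ObsSpace m) × (ObsInput d × ℤˣ) => (q.1, obsAt m q.2.1))
          (measurable_fst.prodMk ((measurable_obsAt m).comp (measurable_fst.comp measurable_snd)))
      refine measurable_to_countable' fun y => ?_
      rcases Int.units_eq_one_or y with rfl | rfl
      · exact h1
      · convert h1.compl using 1
        ext q
        simp only [Set.mem_preimage, Set.mem_singleton_iff, Set.mem_compl_iff, Set.mem_ofPred_eq]
        exact Int.units_ne_iff_eq_neg.symm
    exact ((measurable_pattern.comp (measurable_fst.comp measurable_snd))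
      (measurableSet_singleton m)).inter
        (measurableSet_eq_fun (measurable_snd.comp measurable_snd) hL).compl
  have hset : {ω | M ω = m ∧ Y ω ≠ plugInClassifier Sigma τ (fun i => Xs i ω) (fun i => Ms i ω)
      (fun i => Ys i ω) (observe (X ω) (M ω))} = {ω | (U ω, s₀ ω) ∈ S} := by
    ext ω
    simp only [Set.mem_ofPred_eq, S]
    refine and_congr_right fun h => ?_
    simp only [plugInClassifier, thresholdedMean_eq_sampleMean hn]
    subst h
    simp only [U, F, hs0_def, obsAt_observe rfl]
    rfl
  rw [hset, indepFun_real_mem_eq_integral hindep hU hs0 hS]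
  have hpt (ω : Ω) : P.real {ω' | (U ω, s₀ ω') ∈ S} ≤ RB + p / √(2 * Real.pi) *
      (‖whiten (Sigma m) (sampleMean τ m 1 (fun i => s i ω) - mu m 1)‖ +
        ‖whiten (Sigma m) (sampleMean τ m (-1) (fun i => s i ω) - mu m (-1))‖) := by
    have hH : MeasurableSet {x | ldaRule (Sigma m) (U ω).1 (U ω).2 x = 1} :=
      (measurableSet_ldaRule_eq_one (Sigma m)).preimage (f := fun x => (U ω, x)) (by fun_prop)
    have e : {ω' | (U ω, s₀ ω') ∈ S} = {ω' | M ω' = m ∧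
        Y ω' ≠ ldaRule (Sigma m) (U ω).1 (U ω).2 (restrict m (X ω'))} := by
      ext ω'
      simp only [Set.mem_ofPred_eq, S, hs0_def]
      refine and_congr_right fun h => ?_
      rw [obsAt_observe (show M ω' = m from h)]
    rw [e, pattern_risk_eq hmodel hX hM hY hm hH (fun ω' _ => Iff.rfl), hbayes]
    have h := ldaRule_excess_le (hmodel.posDef m hm) (U ω).1 (U ω).2 (mu m 1) (mu m (-1)) hT
    have hp0 : 0 ≤ p / 2 := div_nonneg measureReal_nonneg two_pos.le
    refine (mul_le_mul_of_nonneg_left h hp0).trans (le_of_eq ?_)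
    simp only [U, F]
    ring
  obtain ⟨hi1, hb1⟩ := integral_whitened_error_le hn hX hM hY hXs hMs hYs hmodel hsample hτ hm 1
  obtain ⟨hi2, hb2⟩ := integral_whitened_error_le hn hX hM hY hXs hMs hYs hmodel hsample hτ hm (-1)
  have hi := (hi1.add hi2).const_mul (p / √(2 * Real.pi))
  have hint : ∫ ω, P.real {ω' | (U ω, s₀ ω') ∈ S} ∂P ≤ RB + p / √(2 * Real.pi) *
      (∫ ω, ‖whiten (Sigma m) (sampleMean τ m 1 (fun i => s i ω) - mu m 1)‖ ∂P +
        ∫ ω, ‖whiten (Sigma m) (sampleMean τ m (-1) (fun i => s i ω) - mu m (-1))‖ ∂P) := by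
    refine (integral_mono (integrable_real_section (P := P) hU hs0 hS)
      ((integrable_const RB).add hi) hpt).trans (le_of_eq ?_)
    rw [integral_add' (integrable_const _) hi, integral_const_mul, integral_add' hi1 hi2,
      integral_const, probReal_univ, one_smul]
  rw [← hp_def, ← hB_def] at hb1 hb2
  have hmin : 0 ≤ min τ p := le_min hτ0 measureReal_nonneg
  have hpi : √Real.pi ≤ √(2 * Real.pi) :=
    Real.sqrt_le_sqrt (by linarith [Real.pi_pos])
  have hpi0 : 0 < √Real.pi := Real.sqrt_pos.2 Real.pi_pos
  calc _ ≤ (√(2 * Real.pi))⁻¹ *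
        (p * ∫ ω, ‖whiten (Sigma m) (sampleMean τ m 1 (fun i => s i ω) - mu m 1)‖ ∂P +
          p * ∫ ω, ‖whiten (Sigma m) (sampleMean τ m (-1) (fun i => s i ω) - mu m (-1))‖ ∂P) := by
        rw [sub_le_iff_le_add']
        refine hint.trans (le_of_eq ?_)
        ring
    _ ≤ (√(2 * Real.pi))⁻¹ * ((2 + 4 * B) * min τ p + (2 + 4 * B) * min τ p) := by
        gcongr
    _ = (4 / √(2 * Real.pi) + 8 / √(2 * Real.pi) * B) * min τ p := by ring
    _ ≤ (4 / √(2 * Real.pi) + 8 / √Real.pi * B) * min τ p := by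
        gcongr

end Risk

end MissingLDA

theorem mainTheorem2 {Ω : Type*} [MeasurableSpace Ω] (P : Measure Ω) [IsProbabilityMeasure P]
    {d n : ℕ} (hn : 0 < n)
    (X : Ω → EuclideanSpace ℝ (Fin d)) (M : Ω → Pattern d) (Y : Ω → ℤˣ)
    (hX : Measurable X) (hM : Measurable M) (hY : Measurable Y)
    (Xs : Fin n → Ω → EuclideanSpace ℝ (Fin d)) (Ms : Fin n → Ω → Pattern d)
    (Ys : Fin n → Ω → ℤˣ)
    (hXs : ∀ i, Measurable (Xs i)) (hMs : ∀ i, Measurable (Ms i)) (hYs : ∀ i, Measurable (Ys i))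
    (mu : (m : Pattern d) → ℤˣ → ObsSpace m)
    (Sigma : (m : Pattern d) → Matrix (ObsIdx m) (ObsIdx m) ℝ)
    (hmodel : IsBalancedGPMMLDA P X M Y mu Sigma)
    (hsample : IsIIDSample P X M Y Xs Ms Ys)
    (τ : ℝ) (hτ : √((d : ℝ) / n) ≤ τ) :
    misRisk P Y (fun ω => plugInClassifier Sigma τ (fun i => Xs i ω) (fun i => Ms i ω)
        (fun i => Ys i ω) (observe (X ω) (M ω))) -
      misRisk P Y (bayesPrediction P (fun ω => observe (X ω) (M ω)) Y) ≤
    ∑ m : Pattern d,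
        (4 / √(2 * Real.pi) + 8 / √Real.pi *
          (max ‖mu m 1‖ ‖mu m (-1)‖ / √(lambdaMin (Sigma m)))) * min τ (patternProb P M m) +
      ∑ m : Pattern d with τ ≤ patternProb P M m,
        √2 * max ‖mu m 1‖ ‖mu m (-1)‖ / √(Real.pi * lambdaMin (Sigma m)) *
          patternProb P M m * (1 - patternProb P M m) ^ ((n : ℝ) / 2) := by
  rw [misRisk_eq_sum hM, misRisk_eq_sum hM, ← Finset.sum_sub_distrib]
  refine (Finset.sum_le_sum fun m _ => pattern_excess_le hn hX hM hY hXs hMs hYs hmodel hsample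
    hτ m).trans (le_add_of_nonneg_right (Finset.sum_nonneg fun m _ => ?_))
  have h0 : 0 ≤ patternProb P M m := measureReal_nonneg
  have h1 : patternProb P M m ≤ 1 := measureReal_le_one
  have h2 : 0 ≤ (1 - patternProb P M m) ^ ((n : ℝ) / 2) := Real.rpow_nonneg (by linarith) _
  positivity
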